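/- Let $E_i,E_o\subset\mathbb R^2$ be two nonempty, bounded, simply connected domains whose boundaries $\Gamma_i=\partial E_i$ and $\Gamma_o=\partial E_o$ are simple closed smooth curves, with $\overline{E_i}\subset E_o$, and let $\Omega=E_o\setminus\overline{E_i}$. Let $a,b,\alpha,\beta$ be real constants and let $u\in C^2(\Omega)\cap C^1(\overline\Omega)$ be a solution of $$\Delta u=-2\ \text{ in }\Omega,\qquad u=a,\ \ \frac{\partial u}{\partial\nu}=\alpha\ \text{ on }\Gamma_i,\qquad u=b,\ \ \frac{\partial u}{\partial\nu}=\beta\ \text{ on }\Gamma_o,$$ where $\nu$ is the unit normal to $\partial\Omega$ pointing outside $\Omega$. Then: * if $a>b$ and $b<u<a$ in $\Omega$, then $4a+\alpha^2>4b+\beta^2$, $\alpha\ge 0$ and $\beta<0$; * if $a<b$ and $a<u<b$ in $\Omega$, then $4a+\alpha^2>4b+\beta^2$, $\alpha<0$ and $\beta\ge 0$. -/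

import Mathlib

open scoped ContDiff

/-- The Euclidean plane. -/
abbrev Plane : Type := EuclideanSpace ℝ (Fin 2)

/-- `Γ` is a simple closed smooth curve: the image of a smooth regular `1`-periodic
parametrization that is injective on a period. -/
def IsSimpleClosedSmoothCurve (Γ : Set Plane) : Prop :=
  ∃ γ : ℝ → Plane, ContDiff ℝ ∞ γ ∧ Function.Periodic γ 1 ∧ (∀ t, deriv γ t ≠ 0) ∧
    Set.InjOn γ (Set.Ico 0 1) ∧ Set.range γ = Γ

/-- A (nonempty) simply connected bounded domain whose boundary is a simple closed smooth curve. -/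
structure IsSmoothJordanDomain (E : Set Plane) : Prop where
  isOpen : IsOpen E
  isSimplyConnected : IsSimplyConnected E
  isBounded : Bornology.IsBounded E
  boundary : IsSimpleClosedSmoothCurve (frontier E)

/-- `ν` is the unit normal to the curve `Γ` at `p ∈ Γ` that points outside `Ω`: it has length one,
it is orthogonal to the velocity at `p` of every curve that lies in `Γ` and passes through `p`,
and, starting at `p`, the direction `ν` leads out of the closure of `Ω`
while the direction `-ν` leads into `Ω`. -/
structure IsOutwardUnitNormal (Γ Ω : Set Plane) (p ν : Plane) : Prop where
  norm_eq_one : ‖ν‖ = 1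
  orthogonal : ∀ (c : ℝ → Plane) (v : Plane), (∀ t, c t ∈ Γ) → c 0 = p → HasDerivAt c v 0 →
    inner ℝ ν v = 0
  outside : ∀ᶠ s : ℝ in nhdsWithin 0 (Set.Ioi 0), p + s • ν ∉ closure Ω
  inside : ∀ᶠ s : ℝ in nhdsWithin 0 (Set.Ioi 0), p - s • ν ∈ Ω

/-- The exterior normal derivative `∂u/∂ν` of `u` at the point `p` of the boundary curve `Γ` of `Ω`
equals `k`. It is a one-sided derivative: for small `s < 0` the point `p + s ν` lies in `Ω`. -/
def HasNormalDeriv (Γ Ω : Set Plane) (u : Plane → ℝ) (p : Plane) (k : ℝ) : Prop :=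
  ∃ ν : Plane, IsOutwardUnitNormal Γ Ω p ν ∧
    HasDerivWithinAt (fun s : ℝ => u (p + s • ν)) k (Set.Iic 0) 0

/-- The region `E_o \ closure E_i` between two nested domains. -/
def ringRegion (Ei Eo : Set Plane) : Set Plane := Eo \ closure Ei

/-- `(Ω, u)` with `Ω = E_o \ closure E_i` is a classical solution, `u ∈ C²(Ω) ∩ C¹(closure Ω)`, of
`Δ u = -2` in `Ω`, `u = a` and `∂u/∂ν = α` on `Γ_i = ∂E_i`, `u = b` and `∂u/∂ν = β` on
`Γ_o = ∂E_o`, where `E_i` is compactly contained in `E_o`.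
Only the values of `u` on the closure of `Ω` matter. -/
structure IsSerrinSolution (Ei Eo : Set Plane) (u : Plane → ℝ) (a b α β : ℝ) : Prop where
  inner_domain : IsSmoothJordanDomain Ei
  outer_domain : IsSmoothJordanDomain Eo
  closure_subset : closure Ei ⊆ Eo
  contDiffOn_interior : ContDiffOn ℝ 2 u (ringRegion Ei Eo)
  contDiffOn_closure : ContDiffOn ℝ 1 u (closure (ringRegion Ei Eo))
  laplacian_eq : ∀ x ∈ ringRegion Ei Eo, Laplacian.laplacian u x = -2
  inner_value : ∀ p ∈ frontier Ei, u p = a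
  inner_normal : ∀ p ∈ frontier Ei, HasNormalDeriv (frontier Ei) (ringRegion Ei Eo) u p α
  outer_value : ∀ p ∈ frontier Eo, u p = b
  outer_normal : ∀ p ∈ frontier Eo, HasNormalDeriv (frontier Eo) (ringRegion Ei Eo) u p β

/-!
The signs of `α` and `β` come from the boundary behaviour of `u`: the weak inequalities are limits of
difference quotients, the strict ones are Hopf's lemma at a boundary point where `u`, which is
superharmonic, attains a minimum.

The inequality between `4 a + α²` and `4 b + β²` compares the values of the `P`-function
`P = |∇u|² + 4 u` on the two boundary curves. Suppose `4 a + α² ≤ M := 4 b + β²`. Where `∇u ≠ 0`, the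
`P`-function satisfies an elliptic inequality with bounded drift, and where `∇u = 0` one has
`P = 4 u ≤ M`; so the maximum principle gives `P ≤ M` in the whole region (`norm_fderiv_sq_add_le`).
Its proof uses that `u + |x|² / 2` is harmonic, hence locally the real part of a holomorphic function.

In other words `√(M - 4 u)` has gradient at most `2`. It equals `|β|` on the outer curve. Let `p` be a
point of the outer curve at maximal distance `R` from the origin, and put `σ = R - |x|`. The distance
from `x` to the outer curve is at most `σ` near `p`, so `|√(M - 4 u) - |β|| ≤ 2 σ` there. Squaring gives
`u ≥ f` if `β ≥ 0` and `u ≤ f` if `β < 0`, where `f = b - β σ - σ²`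
(`IsSerrinSolution.exists_abs_sqrt_sub_abs_le`). Since `Δ f = -2 + (β + 2 σ) / |x|`, the function
`u - f`, respectively `f - u`, is nonnegative and strictly superharmonic near `p`, but it vanishes at `p`
together with its normal derivative. This contradicts Hopf's lemma
(`exists_linear_lower_bound_of_laplacian_neg`) in a ball inside the region that touches the outer curve
at `p` (`IsOutwardUnitNormal.exists_ball_subset`). Boundary regularity of `u` beyond `C¹` is not needed.
-/

section

open Filter Set Metric Topology Laplacian InnerProductSpace

/-! ### The Laplacian, second derivative test, radial functions -/

theorem IsLocalMin.deriv_eq_zero_and_second_deriv_nonneg {φ ψ : ℝ → ℝ} {d : ℝ}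
    (hφ : ∀ᶠ t in 𝓝 0, HasDerivAt φ (ψ t) t) (hψ : HasDerivAt ψ d 0) (hmin : IsLocalMin φ 0) :
    ψ 0 = 0 ∧ 0 ≤ d := by
  have h0 : ψ 0 = 0 := hmin.hasDerivAt_eq_zero hφ.self_of_nhds
  refine ⟨h0, ?_⟩
  by_contra! hd
  have hderiv : deriv φ =ᶠ[𝓝 0] ψ := hφ.mono fun t ht => ht.deriv
  have hdd : deriv (deriv φ) 0 = d := by rw [hderiv.deriv_eq, hψ.deriv]
  have hmax : IsLocalMax φ 0 :=
    isLocalMax_of_deriv_deriv_neg (by rw [hdd]; exact hd) (by rw [hderiv.eq_of_nhds, h0])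
      hφ.self_of_nhds.continuousAt
  have hconst : φ =ᶠ[𝓝 0] fun _ => φ 0 := by
    filter_upwards [hmin, hmax] with t h1 h2 using le_antisymm h2 h1
  have h1 : deriv φ =ᶠ[𝓝 0] fun _ => (0 : ℝ) := by
    have := hconst.deriv
    simpa using this
  have h2 : deriv (deriv φ) 0 = 0 := by rw [h1.deriv_eq]; simp
  linarith

section Laplacian

variable {E : Type*} [NormedAddCommGroup E] [InnerProductSpace ℝ E]

theorem ContDiffAt.eventually_hasDerivAt_line {f : E → ℝ} {x : E} (hf : ContDiffAt ℝ 2 f x)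
    (v : E) :
    ∀ᶠ t : ℝ in 𝓝 0, HasDerivAt (fun t : ℝ => f (x + t • v)) (fderiv ℝ f (x + t • v) v) t := by
  have hev : ∀ᶠ y in 𝓝 x, DifferentiableAt ℝ f y :=
    (hf.eventually (by simp)).mono fun y hy => hy.differentiableAt (by simp)
  have hline : Tendsto (fun t : ℝ => x + t • v) (𝓝 0) (𝓝 x) := by
    have : Continuous fun t : ℝ => x + t • v := by fun_prop
    simpa using this.tendsto 0
  filter_upwards [hline.eventually hev] with t ht
  have h1 : HasDerivAt (fun t : ℝ => x + t • v) v t := by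
    simpa using ((hasDerivAt_id t).smul_const v).const_add x
  exact ht.hasFDerivAt.comp_hasDerivAt t h1

theorem ContDiffAt.hasDerivAt_fderiv_line {f : E → ℝ} {x : E} (hf : ContDiffAt ℝ 2 f x)
    (v : E) :
    HasDerivAt (fun t : ℝ => fderiv ℝ f (x + t • v) v) (fderiv ℝ (fderiv ℝ f) x v v) 0 := by
  have h1 : HasDerivAt (fun t : ℝ => x + t • v) v 0 := by
    simpa using ((hasDerivAt_id (0 : ℝ)).smul_const v).const_add x
  have h2 : DifferentiableAt ℝ (fderiv ℝ f) (x + (0 : ℝ) • v) := by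
    rw [zero_smul, add_zero]
    exact (hf.fderiv_right (m := 1) (by norm_num)).differentiableAt (by simp)
  have h3 := h2.hasFDerivAt.comp_hasDerivAt (0 : ℝ) h1
  have h4 := h3.clm_apply (hasDerivAt_const (0 : ℝ) v)
  simpa using h4

/-- Second derivatives of `f` in a direction can be computed by differentiating twice along a line. -/
theorem ContDiffAt.fderiv_fderiv_eq_of_line {f : E → ℝ} {x v : E} (hf : ContDiffAt ℝ 2 f x)
    {ψ : ℝ → ℝ} {d : ℝ} (hφ : ∀ᶠ t : ℝ in 𝓝 0, HasDerivAt (fun t : ℝ => f (x + t • v)) (ψ t) t)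
    (hψ : HasDerivAt ψ d 0) : fderiv ℝ (fderiv ℝ f) x v v = d := by
  refine (hf.hasDerivAt_fderiv_line v).unique (hψ.congr_of_eventuallyEq ?_)
  filter_upwards [hφ, hf.eventually_hasDerivAt_line v] with t h1 h2 using h2.unique h1

variable [FiniteDimensional ℝ E]

theorem laplacian_eq_sum_fderiv_fderiv {ι : Type*} [Fintype ι] (e : OrthonormalBasis ι ℝ E)
    (f : E → ℝ) (x : E) : Δ f x = ∑ i, fderiv ℝ (fderiv ℝ f) x (e i) (e i) := by
  simp [laplacian_eq_iteratedFDeriv_orthonormalBasis f e, iteratedFDeriv_two_apply]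

theorem IsLocalMin.laplacian_nonneg {f : E → ℝ} {x : E} (hf : ContDiffAt ℝ 2 f x)
    (hmin : IsLocalMin f x) : 0 ≤ Δ f x := by
  rw [laplacian_eq_sum_fderiv_fderiv (stdOrthonormalBasis ℝ E)]
  refine Finset.sum_nonneg fun i _ => ?_
  refine (IsLocalMin.deriv_eq_zero_and_second_deriv_nonneg
    (hf.eventually_hasDerivAt_line _) (hf.hasDerivAt_fderiv_line _) ?_).2
  have hline : Tendsto (fun t : ℝ => x + t • stdOrthonormalBasis ℝ E i) (𝓝 0) (𝓝 x) := by
    have : Continuous fun t : ℝ => x + t • stdOrthonormalBasis ℝ E i := by fun_prop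
    simpa using this.tendsto 0
  have := hline.eventually hmin
  simpa [IsLocalMin, IsMinFilter] using this

theorem laplacian_comp_linearIsometryEquiv {E' : Type*} [NormedAddCommGroup E']
    [InnerProductSpace ℝ E'] [FiniteDimensional ℝ E'] (e : E' ≃ₗᵢ[ℝ] E) {f : E → ℝ} {z : E'}
    (hf : ContDiffAt ℝ 2 f (e z)) : Δ (fun y => f (e y)) z = Δ f (e z) := by
  have hfe : ContDiffAt ℝ 2 (fun y => f (e y)) z :=
    hf.comp z e.contDiff.contDiffAt
  rw [laplacian_eq_sum_fderiv_fderiv (stdOrthonormalBasis ℝ E'),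
    laplacian_eq_sum_fderiv_fderiv ((stdOrthonormalBasis ℝ E').map e)]
  refine Finset.sum_congr rfl fun i _ => ?_
  refine hfe.fderiv_fderiv_eq_of_line (ψ := fun t =>
    fderiv ℝ f (e z + t • ((stdOrthonormalBasis ℝ E').map e i)) ((stdOrthonormalBasis ℝ E').map e i))
    ?_ (hf.hasDerivAt_fderiv_line _)
  simpa using hf.eventually_hasDerivAt_line ((stdOrthonormalBasis ℝ E').map e i)

/-- The Laplacian of a radial function in dimension two, the profile being a function of the
squared distance to the centre `c`. -/
theorem laplacian_radial (hE : Module.finrank ℝ E = 2) {h h' : ℝ → ℝ} {h'' : ℝ} {c x : E}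
    (hC : ContDiffAt ℝ 2 h (‖x - c‖ ^ 2))
    (hh : ∀ᶠ ρ in 𝓝 (‖x - c‖ ^ 2), HasDerivAt h (h' ρ) ρ)
    (hh' : HasDerivAt h' h'' (‖x - c‖ ^ 2)) :
    Δ (fun y => h (‖y - c‖ ^ 2)) x = 4 * h'' * ‖x - c‖ ^ 2 + 4 * h' (‖x - c‖ ^ 2) := by
  have hf : ContDiffAt ℝ 2 (fun y => h (‖y - c‖ ^ 2)) x := by
    refine ContDiffAt.comp x (g := h) (f := fun y => ‖y - c‖ ^ 2) hC ?_
    exact (contDiffAt_id.sub contDiffAt_const).norm_sq ℝ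
  rw [laplacian_eq_sum_fderiv_fderiv (stdOrthonormalBasis ℝ E)]
  have key : ∀ v : E, ‖v‖ = 1 → fderiv ℝ (fderiv ℝ (fun y => h (‖y - c‖ ^ 2))) x v v
      = 4 * h'' * inner ℝ (x - c) v ^ 2 + 2 * h' (‖x - c‖ ^ 2) := by
    intro v hv
    set q : ℝ → ℝ := fun t => ‖x + t • v - c‖ ^ 2 with hq
    have hqeq : q = fun t => ‖x - c‖ ^ 2 + 2 * t * inner ℝ (x - c) v + t ^ 2 := by
      funext t
      have : x + t • v - c = (x - c) + t • v := by abel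
      simp only [hq, this]
      rw [norm_add_sq_real, norm_smul, hv, inner_smul_right]
      simp
      ring
    have hq' : ∀ t, HasDerivAt q (2 * inner ℝ (x - c) v + 2 * t) t := by
      intro t
      rw [hqeq]
      have h1 : HasDerivAt (fun t : ℝ => 2 * t * inner ℝ (x - c) v)
          (2 * 1 * inner ℝ (x - c) v) t := ((hasDerivAt_id t).const_mul 2).mul_const _
      have h2 : HasDerivAt (fun t : ℝ => t ^ 2) (2 * t) t := by simpa using hasDerivAt_pow 2 t
      exact ((h1.const_add _).add h2).congr_deriv (by ring)
    have hq0 : q 0 = ‖x - c‖ ^ 2 := by simp [hq]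
    have hqt : Tendsto q (𝓝 0) (𝓝 (‖x - c‖ ^ 2)) := hq0 ▸ (hq' 0).continuousAt.tendsto
    refine hf.fderiv_fderiv_eq_of_line
      (ψ := fun t => h' (q t) * (2 * inner ℝ (x - c) v + 2 * t)) ?_ ?_
    · filter_upwards [hqt.eventually hh] with t ht
      exact ht.comp t (hq' t)
    · have h1 : HasDerivAt (fun t => h' (q t)) (h'' * (2 * inner ℝ (x - c) v + 2 * 0)) 0 :=
        HasDerivAt.comp (0 : ℝ) (by rw [hq0]; exact hh') (hq' 0)
      have h2 : HasDerivAt (fun t : ℝ => 2 * inner ℝ (x - c) v + 2 * t) 2 0 := by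
        simpa using ((hasDerivAt_id (0 : ℝ)).const_mul 2).const_add (2 * inner ℝ (x - c) v)
      refine (h1.mul h2).congr_deriv ?_
      rw [hq0]
      ring
  rw [Finset.sum_congr rfl fun i _ => key _ ((stdOrthonormalBasis ℝ E).norm_eq_one i)]
  rw [Finset.sum_add_distrib, ← Finset.mul_sum, (stdOrthonormalBasis ℝ E).sum_sq_inner_left]
  simp [hE]
  ring

end Laplacian

/-! ### Hopf's lemma -/

section Hopf

variable {E : Type*} [NormedAddCommGroup E] [InnerProductSpace ℝ E] [FiniteDimensional ℝ E]

theorem laplacian_inv_norm_sq (hE : Module.finrank ℝ E = 2) {c x : E} (hx : x ≠ c) :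
    Δ (fun y => (‖y - c‖ ^ 2)⁻¹) x = 4 / (‖x - c‖ ^ 2) ^ 2 := by
  have hρ : ‖x - c‖ ^ 2 ≠ 0 := by simpa [sub_eq_zero] using hx
  have := laplacian_radial hE (h := fun ρ => ρ⁻¹) (h' := fun ρ => -(ρ ^ 2)⁻¹)
    (h'' := 2 / (‖x - c‖ ^ 2) ^ 3) (c := c) (x := x) (contDiffAt_inv ℝ hρ)
    ((eventually_ne_nhds hρ).mono fun ρ h => hasDerivAt_inv h) ?_
  · rw [this]; field_simp; ring
  · have h2 : HasDerivAt (fun t : ℝ => t ^ 2) (2 * ‖x - c‖ ^ 2) (‖x - c‖ ^ 2) := by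
      simpa using hasDerivAt_pow 2 (‖x - c‖ ^ 2)
    refine ((h2.inv (pow_ne_zero 2 hρ)).neg).congr_deriv ?_
    field_simp

/-- Hopf's boundary point lemma in a ball of radius `r` that touches the boundary at `p`, for a
nonnegative strictly superharmonic function: it grows at least linearly in the inward direction
`-ν`. The statement is of interest when `w p = 0`. On the annulus `r / 2 ≤ ‖x - x₀‖ ≤ r` the
function is compared with a multiple of the strictly subharmonic barrier
`‖x - x₀‖⁻² - r⁻²`, which vanishes on the outer circle. -/
theorem exists_linear_lower_bound_of_laplacian_neg (hE : Module.finrank ℝ E = 2) {w : E → ℝ}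
    {p ν : E} {r : ℝ} (hr : 0 < r) (hν : ‖ν‖ = 1)
    (hcont : ContinuousOn w (closedBall (p - r • ν) r))
    (hdiff : ∀ x ∈ ball (p - r • ν) r, ContDiffAt ℝ 2 w x)
    (hlap : ∀ x ∈ ball (p - r • ν) r, Δ w x < 0)
    (hnonneg : ∀ x ∈ ball (p - r • ν) r, 0 ≤ w x) :
    ∃ c > 0, ∀ s, 0 ≤ s → s ≤ r / 2 → c * s ≤ w (p - s • ν) := by
  set x₀ := p - r • ν with hx₀
  have hpos : ∀ x ∈ ball x₀ r, 0 < w x := by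
    intro x hx
    refine (hnonneg x hx).lt_of_ne fun h0 => ?_
    have hmin : IsLocalMin w x := by
      filter_upwards [isOpen_ball.mem_nhds hx] with y hy
      rw [← h0]; exact hnonneg y hy
    exact absurd (hmin.laplacian_nonneg (hdiff x hx)) (not_le.2 (hlap x hx))
  have hnonneg' : ∀ x ∈ closedBall x₀ r, 0 ≤ w x := by
    have hcl : closure (ball x₀ r) = closedBall x₀ r := closure_ball x₀ hr.ne'
    intro x hx
    have h1 : MapsTo w (closure (ball x₀ r)) (closure (Ici 0)) :=
      MapsTo.closure_of_continuousOn hnonneg (by rwa [hcl])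
    have := h1 (by rwa [hcl])
    simpa using this
  -- the inner half of the ball carries a positive lower bound
  have hsub : closedBall x₀ (r / 2) ⊆ ball x₀ r := closedBall_subset_ball (by linarith)
  obtain ⟨y₀, hy₀, hy₀min⟩ := (isCompact_closedBall x₀ (r / 2)).exists_isMinOn
    ⟨x₀, mem_closedBall_self (by linarith)⟩
    (hcont.mono (hsub.trans ball_subset_closedBall))
  set m := w y₀
  have hm : 0 < m := hpos _ (hsub hy₀)
  -- small enough for the barrier to stay below `m` on the inner circle, where its value is `3 / r ^ 2`
  set ε := m * r ^ 2 / 4 with hε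
  have hεpos : 0 < ε := by positivity
  set A := closedBall x₀ r \ ball x₀ (r / 2) with hA
  have hAc : IsCompact A := (isCompact_closedBall x₀ r).diff isOpen_ball
  have hAd : ∀ x ∈ A, r / 2 ≤ ‖x - x₀‖ ∧ ‖x - x₀‖ ≤ r := by
    intro x hx
    simpa [hA, dist_eq_norm, and_comm] using hx
  set z : E → ℝ := fun x => w x - ε * ((‖x - x₀‖ ^ 2)⁻¹ - (r ^ 2)⁻¹) with hz
  have hνs : ∀ s, 0 ≤ s → s ≤ r / 2 → ‖p - s • ν - x₀‖ = r - s := by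
    intro s hs0 hs
    have : p - s • ν - x₀ = (r - s) • ν := by rw [hx₀, sub_smul]; abel
    rw [this, norm_smul, hν, mul_one, Real.norm_of_nonneg (by linarith)]
  have hAne : A.Nonempty := by
    refine ⟨p - (0 : ℝ) • ν, ?_⟩
    have := hνs 0 le_rfl (by linarith)
    rw [hA]
    simp only [Set.mem_sdiff, mem_closedBall, mem_ball, dist_eq_norm, this]
    constructor <;> linarith
  have hzc : ContinuousOn z A := by
    refine (hcont.mono sdiff_subset).sub (continuousOn_const.mul (ContinuousOn.sub
      (ContinuousOn.inv₀ (by fun_prop) ?_) continuousOn_const))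
    intro x hx
    have : 0 < ‖x - x₀‖ := by linarith [(hAd x hx).1]
    positivity
  obtain ⟨x₁, hx₁, hx₁min⟩ := hAc.exists_isMinOn hAne hzc
  have hz₁ : 0 ≤ z x₁ := by
    obtain ⟨h1, h2⟩ := hAd x₁ hx₁
    -- a minimum of `z` lies on the outer circle, on the inner circle, or (impossible) in between
    rcases eq_or_lt_of_le h2 with h2 | h2
    · simp only [hz, h2, sub_self, mul_zero, sub_zero]
      exact hnonneg' _ hx₁.1
    rcases eq_or_lt_of_le h1 with h1 | h1
    · have hw : m ≤ w x₁ := hy₀min (by simp [dist_eq_norm, ← h1])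
      have : ε * ((‖x₁ - x₀‖ ^ 2)⁻¹ - (r ^ 2)⁻¹) = m * (3 / 4) := by
        rw [← h1, hε]; field_simp; norm_num
      simp only [hz, this]
      linarith
    · exfalso
      have hx₁b : x₁ ∈ ball x₀ r := by simpa [dist_eq_norm] using h2
      have hne : x₁ ≠ x₀ := by
        rintro rfl
        simp at h1
        linarith
      have hmin : IsLocalMin z x₁ := by
        have : A ∈ 𝓝 x₁ := by
          have ho : IsOpen (ball x₀ r ∩ (closedBall x₀ (r / 2))ᶜ) :=
            isOpen_ball.inter isClosed_closedBall.isOpen_compl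
          refine mem_of_superset (ho.mem_nhds ⟨hx₁b, by simpa [dist_eq_norm] using h1⟩) ?_
          rintro y ⟨hy1, hy2⟩
          exact ⟨ball_subset_closedBall hy1, fun h => hy2 (ball_subset_closedBall h)⟩
        exact hx₁min.isLocalMin this
      have hb : ContDiffAt ℝ 2 (fun x => (‖x - x₀‖ ^ 2)⁻¹) x₁ := by
        refine ContDiffAt.inv ((contDiffAt_id.sub contDiffAt_const).norm_sq ℝ) ?_
        simpa [sub_eq_zero] using hne
      have hzeq : z = w - (ε • (fun x => (‖x - x₀‖ ^ 2)⁻¹) - fun _ => ε * (r ^ 2)⁻¹) := by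
        funext x
        simp [hz]; ring
      have hb' : ContDiffAt ℝ 2 (ε • fun x => (‖x - x₀‖ ^ 2)⁻¹) x₁ := hb.const_smul ε
      have hb'' : ContDiffAt ℝ 2
          ((ε • fun x => (‖x - x₀‖ ^ 2)⁻¹) - fun _ => ε * (r ^ 2)⁻¹) x₁ := hb'.sub contDiffAt_const
      have hlapz : Δ z x₁ = Δ w x₁ - ε * (4 / (‖x₁ - x₀‖ ^ 2) ^ 2) := by
        rw [hzeq, (hdiff _ hx₁b).laplacian_sub hb'',
          hb'.laplacian_sub contDiffAt_const, laplacian_smul ε hb,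
          laplacian_inv_norm_sq hE hne]
        simp
      have hzC : ContDiffAt ℝ 2 z x₁ := by
        rw [hzeq]
        exact (hdiff _ hx₁b).sub hb''
      have h3 := hmin.laplacian_nonneg hzC
      rw [hlapz] at h3
      have h4 : 0 < ε * (4 / (‖x₁ - x₀‖ ^ 2) ^ 2) := by
        have : 0 < ‖x₁ - x₀‖ := by linarith
        positivity
      linarith [hlap _ hx₁b]
  refine ⟨ε / r ^ 3, by positivity, fun s hs0 hs => ?_⟩
  have hn := hνs s hs0 hs
  have hmem : p - s • ν ∈ A := by
    rw [hA]
    simp only [Set.mem_sdiff, mem_closedBall, mem_ball, dist_eq_norm, hn]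
    constructor <;> linarith
  have h5 : 0 ≤ z (p - s • ν) := hz₁.trans (hx₁min hmem)
  simp only [hz, hn] at h5
  have h6 : s / r ^ 3 ≤ ((r - s) ^ 2)⁻¹ - (r ^ 2)⁻¹ := by
    have hrs : 0 < r - s := by linarith
    have : ((r - s) ^ 2)⁻¹ - (r ^ 2)⁻¹ = (s * (2 * r - s)) / ((r - s) ^ 2 * r ^ 2) := by
      field_simp; ring
    rw [this, div_le_div_iff₀ (by positivity) (by positivity)]
    have e1 : (r - s) ^ 2 ≤ r ^ 2 := by nlinarith
    have e2 : r ≤ 2 * r - s := by linarith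
    have e3 : (r - s) ^ 2 * r ^ 2 ≤ (2 * r - s) * r ^ 3 := by
      calc (r - s) ^ 2 * r ^ 2 ≤ r ^ 2 * r ^ 2 := by gcongr
        _ = r * r ^ 3 := by ring
        _ ≤ (2 * r - s) * r ^ 3 := by gcongr
    nlinarith
  have h7 := mul_le_mul_of_nonneg_left h6 hεpos.le
  have h8 : ε / r ^ 3 * s = ε * (s / r ^ 3) := by ring
  linarith

end Hopf

/-! ### The maximum principle for the P-function -/

section PFunction

open Complex ComplexConjugate

theorem laplacian_half_norm_sq (z : ℂ) : Δ (fun y : ℂ => ‖y‖ ^ 2 / 2 : ℂ → ℝ) z = (2 : ℝ) := by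
  have := laplacian_radial Complex.finrank_real_complex (h := fun ρ => ρ / 2) (h' := fun _ => 1 / 2)
    (h'' := 0) (c := 0) (x := z) (by fun_prop)
    (Eventually.of_forall fun ρ => (hasDerivAt_id ρ).div_const 2) (hasDerivAt_const _ _)
  simp only [sub_zero] at this
  rw [this]; norm_num

/-- Since `U + ‖z‖² / 2` is harmonic, a solution of `Δ U = -2` is locally
`Re H - ‖z‖² / 2` with `H` holomorphic. This supplies the third derivatives of `U`. -/
theorem exists_analyticOnNhd_of_laplacian_eq_neg_two {U : ℂ → ℝ} {z₀ : ℂ} {R : ℝ}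
    (hU : ∀ z ∈ ball z₀ R, ContDiffAt ℝ 2 U z) (hlap : ∀ z ∈ ball z₀ R, Δ U z = -2) :
    ∃ H : ℂ → ℂ, AnalyticOnNhd ℂ H (ball z₀ R) ∧
      ∀ z ∈ ball z₀ R, U z = (H z).re - ‖z‖ ^ 2 / 2 := by
  have hsq : ∀ z : ℂ, ContDiffAt ℝ 2 (fun y : ℂ => ‖y‖ ^ 2 / 2) z := fun z =>
    (contDiffAt_id.norm_sq ℝ).div_const 2
  have hharm : HarmonicOnNhd (U + fun y : ℂ => ‖y‖ ^ 2 / 2) (ball z₀ R) := by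
    intro z hz
    refine ⟨(hU z hz).add (hsq z), ?_⟩
    filter_upwards [isOpen_ball.mem_nhds hz] with y hy
    rw [(hU y hy).laplacian_add (hsq y), hlap y hy, laplacian_half_norm_sq]
    simp
  obtain ⟨H, hH, hre⟩ := hharm.exists_analyticOnNhd_ball_re_eq
  refine ⟨H, hH, fun z hz => ?_⟩
  have := hre hz
  simp only [Pi.add_apply] at this
  linarith

theorem hasFDerivAt_re_sub_half_norm_sq {H : ℂ → ℂ} {z : ℂ} (hH : AnalyticAt ℂ H z) :
    HasFDerivAt (fun y : ℂ => (H y).re - ‖y‖ ^ 2 / 2) (innerSL ℝ (conj (deriv H z) - z)) z := by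
  have h1 := (hH.differentiableAt.hasDerivAt.hasFDerivAt).restrictScalars ℝ
  have h2 := reCLM.hasFDerivAt.comp z h1
  have h3 := (hasStrictFDerivAt_norm_sq z).hasFDerivAt.const_mul (1 / 2 : ℝ)
  have h4 := h2.sub h3
  refine (h4.congr_of_eventuallyEq (Eventually.of_forall fun y => ?_)).congr_fderiv ?_
  · simp; ring
  · ext v
    simp [Complex.inner]
    ring

/-- The second derivative test for the perturbed `P`-function `P + c exp (l Re z)`, where
`P = |∇U|² + 4 U` and `Δ U = -2`: at a local maximum the gradient of `U` has size at most `4 / l`.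

Write `U = Re H - |z|² / 2`, `F = H'`, `A = F'` and `G = F - conj z`, so that `|∇U| = |G|`. Then
`Δ P = 4 |A|² - 4`, and the vanishing of the gradient of the perturbed function reads
`A conj G = -(G + δ / 2)` with `δ = c l exp (l Re z)`. Hence `|A|` is at least about `1 - δ / (2 |G|)`, and
`Δ P + l δ ≤ 0` forces `l |G| ≤ 4`. -/
theorem mul_norm_fderiv_le_of_isLocalMax {U P : ℂ → ℝ} {z₀ : ℂ} {R l c : ℝ}
    (hR : 0 < R) (hU : ∀ z ∈ ball z₀ R, ContDiffAt ℝ 2 U z)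
    (hlap : ∀ z ∈ ball z₀ R, Δ U z = -2)
    (hP : ∀ z ∈ ball z₀ R, P z = ‖fderiv ℝ U z‖ ^ 2 + 4 * U z) (hl : 0 < l) (hc : 0 < c)
    (hmax : IsLocalMax (fun z => P z + c * Real.exp (l * z.re)) z₀) :
    l * ‖fderiv ℝ U z₀‖ ≤ 4 := by
  obtain ⟨H, hH, hUH⟩ := exists_analyticOnNhd_of_laplacian_eq_neg_two hU hlap
  have hfd : ∀ z ∈ ball z₀ R, ‖fderiv ℝ U z‖ = ‖deriv H z - conj z‖ := by
    intro z hz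
    have : fderiv ℝ U z = innerSL ℝ (conj (deriv H z) - z) := by
      refine HasFDerivAt.fderiv ((hasFDerivAt_re_sub_half_norm_sq (hH z hz)).congr_of_eventuallyEq ?_)
      filter_upwards [isOpen_ball.mem_nhds hz] with y hy using hUH y hy
    rw [this, innerSL_apply_norm, ← Complex.norm_conj]
    simp
  have hF := hH.deriv
  have hF' := hF.deriv
  set F := deriv H
  have hz₀ : z₀ ∈ ball z₀ R := mem_ball_self hR
  -- first and second derivatives along the line `z₀ + t v`
  have key : ∀ v : ℂ,
      2 * (inner ℝ (F z₀ - conj z₀) (deriv F z₀ * v - conj v)) + 4 * (F z₀ * v).re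
        - 4 * inner ℝ z₀ v + c * (l * v.re * Real.exp (l * z₀.re)) = 0 ∧
      2 * (inner ℝ (F z₀ - conj z₀) (deriv (deriv F) z₀ * v * v)
          + ‖deriv F z₀ * v - conj v‖ ^ 2)
        + 4 * (deriv F z₀ * v * v).re - 4 * ‖v‖ ^ 2
        + c * (l * v.re * (l * v.re * Real.exp (l * z₀.re))) ≤ 0 := by
    intro v
    have hline : ∀ t : ℝ, HasDerivAt (fun t : ℝ => z₀ + t • v) v t := fun t => by
      simpa using ((hasDerivAt_id t).smul_const v).const_add z₀
    have hcomp : ∀ {f : ℂ → ℂ} {t : ℝ}, AnalyticAt ℂ f (z₀ + t • v) →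
        HasDerivAt (fun t : ℝ => f (z₀ + t • v)) (deriv f (z₀ + t • v) * v) t := by
      intro f t hf
      have := (hf.differentiableAt.hasDerivAt.hasFDerivAt.restrictScalars ℝ).comp_hasDerivAt t
        (hline t)
      exact this.congr_deriv (by simp [mul_comm])
    have hconj : ∀ t : ℝ, HasDerivAt (fun t : ℝ => conj (z₀ + t • v)) (conj v) t := fun t =>
      conjCLE.toContinuousLinearMap.hasFDerivAt.comp_hasDerivAt t (hline t)
    have hre : ∀ t : ℝ, HasDerivAt (fun t : ℝ => (z₀ + t • v).re) v.re t := fun t =>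
      reCLM.hasFDerivAt.comp_hasDerivAt t (hline t)
    have hexp : ∀ t : ℝ, HasDerivAt (fun t : ℝ => Real.exp (l * (z₀ + t • v).re))
        (l * v.re * Real.exp (l * (z₀ + t • v).re)) t := fun t => by
      exact (((hre t).const_mul l).exp).congr_deriv (by ring)
    have htend : Tendsto (fun t : ℝ => z₀ + t • v) (𝓝 0) (𝓝 z₀) := by
      simpa using (hline 0).continuousAt.tendsto
    have hball : ∀ᶠ t : ℝ in 𝓝 0, z₀ + t • v ∈ ball z₀ R :=
      htend.eventually (isOpen_ball.mem_nhds hz₀)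
    set φ : ℝ → ℝ := fun t => ‖F (z₀ + t • v) - conj (z₀ + t • v)‖ ^ 2 + 4 * (H (z₀ + t • v)).re
      - 2 * ‖z₀ + t • v‖ ^ 2 + c * Real.exp (l * (z₀ + t • v).re) with hφ
    set ψ : ℝ → ℝ := fun t => 2 * (inner ℝ (F (z₀ + t • v) - conj (z₀ + t • v))
        (deriv F (z₀ + t • v) * v - conj v)) + 4 * (F (z₀ + t • v) * v).re
        - 4 * inner ℝ (z₀ + t • v) v + c * (l * v.re * Real.exp (l * (z₀ + t • v).re)) with hψ
    have hφd : ∀ᶠ t : ℝ in 𝓝 0, HasDerivAt φ (ψ t) t := by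
      filter_upwards [hball] with t ht
      have e1 := ((hcomp (hF _ ht)).sub (hconj t)).norm_sq
      have e2 := (reCLM.hasFDerivAt.comp_hasDerivAt t (hcomp (hH _ ht))).const_mul 4
      have e3 := (hline t).norm_sq.const_mul 2
      have e4 := (hexp t).const_mul c
      refine (((e1.add e2).sub e3).add e4).congr_deriv ?_
      simp only [hψ, Complex.reCLM_apply, Pi.sub_apply]
      ring
    have hz0 : z₀ + (0 : ℝ) • v = z₀ := by simp
    have hψd : HasDerivAt ψ (2 * (inner ℝ (F z₀ - conj z₀) (deriv (deriv F) z₀ * v * v)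
          + ‖deriv F z₀ * v - conj v‖ ^ 2)
        + 4 * (deriv F z₀ * v * v).re - 4 * ‖v‖ ^ 2
        + c * (l * v.re * (l * v.re * Real.exp (l * z₀.re)))) 0 := by
      have e1 := (((hcomp (t := 0) (by rw [hz0]; exact hF _ hz₀)).sub (hconj 0)).inner ℝ
        (((hcomp (t := 0) (by rw [hz0]; exact hF' _ hz₀)).mul_const v).sub_const (conj v))).const_mul 2
      have e2 := (reCLM.hasFDerivAt.comp_hasDerivAt (0 : ℝ)
        ((hcomp (t := 0) (by rw [hz0]; exact hF _ hz₀)).mul_const v)).const_mul 4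
      have e3 := ((hline 0).inner ℝ (hasDerivAt_const (0 : ℝ) v)).const_mul 4
      have e4 := ((hexp 0).const_mul (l * v.re)).const_mul c
      refine (((e1.add e2).sub e3).add e4).congr_deriv ?_
      simp only [hz0, Complex.reCLM_apply, Pi.sub_apply, inner_zero_right, zero_add, real_inner_self_eq_norm_sq]
    have hmin : IsLocalMin (fun t => -φ t) 0 := by
      have h1 := htend.eventually hmax
      filter_upwards [h1, hball] with t ht htb
      have e : ∀ t : ℝ, z₀ + t • v ∈ ball z₀ R →
          φ t = P (z₀ + t • v) + c * Real.exp (l * (z₀ + t • v).re) := by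
        intro t ht
        rw [hP _ ht, hfd _ ht, hUH _ ht]
        simp only [hφ]
        ring
      rw [neg_le_neg_iff, e t htb, e 0 (by rwa [hz0]), hz0]
      exact ht
    have := IsLocalMin.deriv_eq_zero_and_second_deriv_nonneg
      (hφd.mono fun t ht => ht.neg) hψd.neg hmin
    refine ⟨?_, by linarith [this.2]⟩
    have h0 : ψ 0 = 0 := by linarith [this.1]
    simpa only [hψ, hz0] using h0
  obtain ⟨k1, k2⟩ := key 1
  obtain ⟨k3, k4⟩ := key I
  rw [hfd _ hz₀]
  set G := F z₀ - conj z₀ with hG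
  have hFG : F z₀ = G + conj z₀ := by rw [hG]; ring
  rw [hFG] at k1 k3
  set A := deriv F z₀
  set B := deriv (deriv F) z₀
  set δ := c * l * Real.exp (l * z₀.re) with hδ
  have hδpos : 0 < δ := by positivity
  have hn : ∀ w : ℂ, ‖w‖ ^ 2 = w.re ^ 2 + w.im ^ 2 := fun w => by
    rw [Complex.sq_norm, Complex.normSq_apply]; ring
  simp only [Complex.inner, hn] at k1 k2 k3 k4
  simp at k1 k2 k3 k4
  -- `q1` and `q2` are the real and imaginary parts of the first-order condition,
  -- `q3` is the second-order condition
  have q1 : 2 * (G.re * A.re + G.im * A.im) + 2 * G.re + δ = 0 := by rw [hδ]; linarith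
  have q2 : G.im * A.re - G.re * A.im = G.im := by linarith
  have q3 : 4 * (A.re ^ 2 + A.im ^ 2) - 4 + l * δ ≤ 0 := by rw [hδ]; nlinarith
  have hg := hn G
  set g := ‖G‖
  have hg0 : 0 ≤ g := norm_nonneg _
  have hre : -g ≤ G.re := neg_le_of_abs_le (Complex.abs_re_le_norm G)
  have q4 : (A.re ^ 2 + A.im ^ 2) * g ^ 2
      = (G.re * A.re + G.im * A.im) ^ 2 + (G.im * A.re - G.re * A.im) ^ 2 := by rw [hg]; ring
  have q5 : G.re * A.re + G.im * A.im = -(G.re + δ / 2) := by linarith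
  rw [q2, q5] at q4
  have q6 : (A.re ^ 2 + A.im ^ 2) * g ^ 2 = g ^ 2 + G.re * δ + δ ^ 2 / 4 := by rw [q4, hg]; ring
  have q7 : δ * (l * g ^ 2) ≤ δ * (4 * g) := by
    nlinarith [mul_le_mul_of_nonneg_right q3 (sq_nonneg g), mul_le_mul_of_nonneg_left hre hδpos.le]
  have q8 : l * g ^ 2 ≤ 4 * g := le_of_mul_le_mul_left q7 hδpos
  rcases hg0.eq_or_lt with h | h
  · rw [← h]; norm_num
  · exact le_of_mul_le_mul_right (by linarith [q8, pow_two g]) h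

/-- The maximum principle for the `P`-function `P = |∇U|² + 4 U` of a solution of `Δ U = -2` in a
bounded open set. If the bound `M` failed inside, then a small perturbation of `P` would have an
interior maximum at which `|∇U|² = P - 4 U` is bounded below, the critical points of `U` being
harmless because `4 U ≤ M`. -/
theorem norm_fderiv_sq_add_le_complex {Ω : Set ℂ} (hΩ : IsOpen Ω) (hb : Bornology.IsBounded Ω)
    {U P : ℂ → ℝ} {M : ℝ} (hU : ContDiffOn ℝ 2 U Ω) (hlap : ∀ z ∈ Ω, Δ U z = -2)
    (hPc : ContinuousOn P (closure Ω))
    (hP : ∀ z ∈ Ω, P z = ‖fderiv ℝ U z‖ ^ 2 + 4 * U z)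
    (hfr : ∀ z ∈ frontier Ω, P z ≤ M) (hUM : ∀ z ∈ Ω, 4 * U z ≤ M) :
    ∀ z ∈ Ω, P z ≤ M := by
  intro z' hz'
  by_contra! hlt
  obtain ⟨K, hK⟩ := hb.closure.exists_norm_le
  set η := (P z' - M) / 2 with hη
  have hηpos : 0 < η := by linarith
  -- any numerator above `4` contradicts the second derivative test
  set l := 5 / √η with hl
  have hs : 0 < √η := Real.sqrt_pos.2 hηpos
  have hlpos : 0 < l := by positivity
  set c := η / Real.exp (l * K) with hc
  have hcpos : 0 < c := by positivity
  have hce : ∀ z ∈ closure Ω, c * Real.exp (l * z.re) ≤ η := by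
    intro z hz
    have h1 : z.re ≤ K := (Complex.re_le_norm z).trans (hK z hz)
    have h2 : Real.exp (l * z.re) ≤ Real.exp (l * K) := by gcongr
    calc c * Real.exp (l * z.re) ≤ c * Real.exp (l * K) := by gcongr
      _ = η := by rw [hc]; field_simp
  have hcomp : IsCompact (closure Ω) := hb.isCompact_closure
  obtain ⟨z₀, hz₀, hmax⟩ := hcomp.exists_isMaxOn ⟨z', subset_closure hz'⟩
    (f := fun z => P z + c * Real.exp (l * z.re)) (hPc.add (by fun_prop))
  have h1 : P z' + c * Real.exp (l * z'.re) ≤ P z₀ + c * Real.exp (l * z₀.re) :=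
    hmax (subset_closure hz')
  have h2 := hce z₀ hz₀
  have h3 : 0 < c * Real.exp (l * z'.re) := by positivity
  have h4 : M + η < P z₀ := by linarith
  have hz₀Ω : z₀ ∈ Ω := by
    by_contra h
    have := hfr z₀ ⟨hz₀, by rwa [hΩ.interior_eq]⟩
    linarith
  obtain ⟨R, hR, hsub⟩ := Metric.isOpen_iff.1 hΩ z₀ hz₀Ω
  have h5 := mul_norm_fderiv_le_of_isLocalMax hR
    (fun z hz => (hU z (hsub hz)).contDiffAt (hΩ.mem_nhds (hsub hz)))
    (fun z hz => hlap z (hsub hz)) (fun z hz => hP z (hsub hz)) hlpos hcpos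
    (hmax.isLocalMax (mem_of_superset (hΩ.mem_nhds hz₀Ω) subset_closure))
  have h6 : η ≤ ‖fderiv ℝ U z₀‖ ^ 2 := by linarith [hP z₀ hz₀Ω, hUM z₀ hz₀Ω]
  have h7 : √η ≤ ‖fderiv ℝ U z₀‖ := by
    rw [Real.sqrt_le_left (norm_nonneg _)]
    exact h6
  have h8 : l * √η = 5 := by rw [hl]; field_simp
  nlinarith

end PFunction

/-- The maximum principle for the `P`-function, transported to any two-dimensional space. -/
theorem norm_fderiv_sq_add_le {E : Type*} [NormedAddCommGroup E] [InnerProductSpace ℝ E]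
    [FiniteDimensional ℝ E] (hE : Module.finrank ℝ E = 2) {Ω : Set E} (hΩ : IsOpen Ω)
    (hb : Bornology.IsBounded Ω)
    {u P : E → ℝ} {M : ℝ} (hu : ContDiffOn ℝ 2 u Ω) (hlap : ∀ z ∈ Ω, Δ u z = -2)
    (hPc : ContinuousOn P (closure Ω))
    (hP : ∀ z ∈ Ω, P z = ‖fderiv ℝ u z‖ ^ 2 + 4 * u z)
    (hfr : ∀ z ∈ frontier Ω, P z ≤ M) (huM : ∀ z ∈ Ω, 4 * u z ≤ M) :
    ∀ z ∈ Ω, P z ≤ M := by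
  let e : ℂ ≃ₗᵢ[ℝ] E := Complex.orthonormalBasisOneI.equiv
    ((stdOrthonormalBasis ℝ E).reindex (finCongr hE)) (Equiv.refl _)
  have hcl : closure (e ⁻¹' Ω) = e ⁻¹' closure Ω :=
    (e.toHomeomorph.preimage_closure Ω).symm
  have hfrt : frontier (e ⁻¹' Ω) = e ⁻¹' frontier Ω :=
    (e.toHomeomorph.preimage_frontier Ω).symm
  have := norm_fderiv_sq_add_le_complex (Ω := e ⁻¹' Ω) (U := fun z => u (e z))
    (P := fun z => P (e z)) (M := M) (hΩ.preimage e.continuous)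
    (e.symm.lipschitz.isBounded_image hb |>.subset fun z hz => ⟨e z, hz, by simp⟩)
    (hu.comp e.contDiff.contDiffOn (mapsTo_preimage _ _))
    (fun z hz => by
      rw [laplacian_comp_linearIsometryEquiv e ((hu _ hz).contDiffAt (hΩ.mem_nhds hz)), hlap _ hz])
    (by rw [hcl]; exact hPc.comp e.continuous.continuousOn (mapsTo_preimage _ _))
    (fun z hz => by
      have h1 : fderiv ℝ (fun z => u (e z)) z
          = (fderiv ℝ u (e z)).comp (e.toContinuousLinearEquiv : ℂ →L[ℝ] E) :=
        e.toContinuousLinearEquiv.comp_right_fderiv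
      rw [h1]
      have h2 : ‖(fderiv ℝ u (e z)).comp (e.toContinuousLinearEquiv : ℂ →L[ℝ] E)‖
          = ‖fderiv ℝ u (e z)‖ :=
        ContinuousLinearMap.opNorm_comp_linearIsometryEquiv (fderiv ℝ u (e z)) e
      rw [h2]
      exact hP _ hz)
    (fun z hz => hfr _ (by rw [hfrt] at hz; exact hz)) (fun z hz => huM _ hz)
  intro z hz
  simpa using this (e.symm z) (by simpa using hz)

/-! ### Boundary curves: interior balls and normal derivatives -/

section Curves

variable {E : Type*} [NormedAddCommGroup E] [InnerProductSpace ℝ E]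

/-- By Taylor's formula a regular curve leaves its tangent line at most quadratically. -/
theorem exists_mul_abs_inner_le_norm_sq_nhds {γ : ℝ → E} (hγ : ContDiff ℝ 2 γ) {t : ℝ}
    (hreg : deriv γ t ≠ 0) {ν : E} (horth : inner ℝ ν (deriv γ t) = 0) :
    ∃ r > 0, ∀ᶠ x in 𝓝 t, 2 * r * |inner ℝ ν (γ x - γ t)| ≤ ‖γ x - γ t‖ ^ 2 := by
  have hγ' : ContDiff ℝ 1 (deriv γ) := hγ.deriv' (n := 1)
  obtain ⟨K, s, hs, hK⟩ := hγ'.contDiffAt.exists_lipschitzOnWith (x := t)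
  set m := ‖deriv γ t‖ with hm
  have hmpos : 0 < m := norm_pos_iff.2 hreg
  obtain ⟨ε, hε, hball⟩ := Metric.mem_nhds_iff.1 hs
  set δ := min ε (m / (2 * (K + 1))) with hδ
  have hδpos : 0 < δ := by positivity
  have hKδ : K * δ ≤ m / 2 := by
    have h1 : δ ≤ m / (2 * (K + 1)) := min_le_right _ _
    have h2 : (K : ℝ) * δ ≤ (K + 1) * (m / (2 * (K + 1))) := by
      gcongr; linarith
    have h3 : ((K : ℝ) + 1) * (m / (2 * (K + 1))) = m / 2 := by field_simp
    linarith
  refine ⟨m ^ 2 / (8 * (‖ν‖ * K + 1)), by positivity, ?_⟩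
  filter_upwards [ball_mem_nhds t hδpos] with x hx
  have hxt : |x - t| < δ := by simpa [Real.dist_eq] using hx
  have htaylor : ‖γ x - γ t - (x - t) • deriv γ t‖ ≤ K * |x - t| * |x - t| := by
    have hd : ∀ y ∈ closedBall t |x - t|, HasDerivWithinAt (fun y => γ y - y • deriv γ t)
        (deriv γ y - deriv γ t) (closedBall t |x - t|) y := by
      intro y _
      have h1 := (hγ.differentiable (by norm_num) y).hasDerivAt
      have h2 : HasDerivAt (fun y : ℝ => y • deriv γ t) (deriv γ t) y := by
        simpa using (hasDerivAt_id y).smul_const (deriv γ t)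
      exact (h1.sub h2).hasDerivWithinAt
    have hb : ∀ y ∈ closedBall t |x - t|, ‖deriv γ y - deriv γ t‖ ≤ K * |x - t| := by
      intro y hy
      have hy' : y ∈ s := hball (by
        have := mem_closedBall.1 hy
        exact mem_ball.2 (this.trans_lt (hxt.trans_le (min_le_left _ _))))
      have h1 := hK.dist_le_mul y hy' t (mem_of_mem_nhds hs)
      rw [dist_eq_norm] at h1
      exact h1.trans (mul_le_mul_of_nonneg_left (mem_closedBall.1 hy) K.2)
    have := (convex_closedBall t |x - t|).norm_image_sub_le_of_norm_hasDerivWithin_le hd hb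
      (mem_closedBall_self (abs_nonneg _)) (y := x) (by simp [Real.dist_eq])
    rw [Real.norm_eq_abs] at this
    convert this using 2
    rw [sub_smul]; abel
  set a := |x - t| with ha
  have ha0 : 0 ≤ a := abs_nonneg _
  have h1 : |inner ℝ ν (γ x - γ t)| ≤ ‖ν‖ * (K * a * a) := by
    have : inner ℝ ν (γ x - γ t) = inner ℝ ν (γ x - γ t - (x - t) • deriv γ t) := by
      rw [inner_sub_right _ (γ x - γ t), inner_smul_right, horth, mul_zero, sub_zero]
    rw [this]
    exact (abs_real_inner_le_norm _ _).trans (mul_le_mul_of_nonneg_left htaylor (norm_nonneg _))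
  have h2 : m / 2 * a ≤ ‖γ x - γ t‖ := by
    have e1 : ‖(x - t) • deriv γ t‖ = a * m := by rw [norm_smul, Real.norm_eq_abs]
    have e2 := norm_sub_norm_le ((x - t) • deriv γ t) ((x - t) • deriv γ t - (γ x - γ t))
    rw [sub_sub_cancel, norm_sub_rev, e1] at e2
    have e3 : K * a * a ≤ m / 2 * a := by
      have : (K : ℝ) * a ≤ K * δ := by gcongr
      gcongr; linarith
    linarith
  have h3 : (m / 2 * a) ^ 2 ≤ ‖γ x - γ t‖ ^ 2 := by gcongr
  have h4 : 2 * (m ^ 2 / (8 * (‖ν‖ * K + 1))) * (‖ν‖ * (K * a * a)) ≤ (m / 2 * a) ^ 2 := by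
    have e1 : 2 * (m ^ 2 / (8 * (‖ν‖ * K + 1))) * (‖ν‖ * (K * a * a))
        = (m / 2 * a) ^ 2 * ((‖ν‖ * K) / (‖ν‖ * K + 1)) := by field_simp; ring
    rw [e1]
    refine mul_le_of_le_one_right (by positivity) ?_
    rw [div_le_one (by positivity)]
    linarith
  refine le_trans ?_ (h4.trans h3)
  gcongr

/-- A closed regular `C²` curve satisfies a two-sided ball condition at `p`: the inequality says that
the open balls of radius `r` centred at `p ± r ν` do not meet the curve. -/
theorem exists_mul_abs_inner_le_norm_sq {γ : ℝ → E} (hγ : ContDiff ℝ 2 γ)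
    (hper : Function.Periodic γ 1) (hreg : ∀ t, deriv γ t ≠ 0) {p ν : E}
    (horth : ∀ t, γ t = p → inner ℝ ν (deriv γ t) = 0) :
    ∃ r > 0, ∀ t, 2 * r * |inner ℝ ν (γ t - p)| ≤ ‖γ t - p‖ ^ 2 := by
  have main : ∃ r > 0, ∀ t ∈ Icc (0 : ℝ) 1, 2 * r * |inner ℝ ν (γ t - p)| ≤ ‖γ t - p‖ ^ 2 := by
    refine isCompact_Icc.induction_on
      (p := fun s => ∃ r > 0, ∀ t ∈ s, 2 * r * |inner ℝ ν (γ t - p)| ≤ ‖γ t - p‖ ^ 2) ?_ ?_ ?_ ?_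
    · exact ⟨1, one_pos, by simp⟩
    · rintro s t hst ⟨r, hr, h⟩
      exact ⟨r, hr, fun x hx => h x (hst hx)⟩
    · rintro s t ⟨r₁, hr₁, h₁⟩ ⟨r₂, hr₂, h₂⟩
      refine ⟨min r₁ r₂, lt_min hr₁ hr₂, ?_⟩
      rintro x (hx | hx)
      · refine le_trans ?_ (h₁ x hx)
        gcongr; exact min_le_left _ _
      · refine le_trans ?_ (h₂ x hx)
        gcongr; exact min_le_right _ _
    · intro t _
      by_cases htp : γ t = p
      · obtain ⟨r, hr, h⟩ := exists_mul_abs_inner_le_norm_sq_nhds hγ (hreg t) (horth t htp)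
        rw [htp] at h
        exact ⟨_, mem_nhdsWithin_of_mem_nhds h, r, hr, fun x hx => hx⟩
      · have hd : 0 < ‖γ t - p‖ ^ 2 := by
          have : 0 < ‖γ t - p‖ := norm_pos_iff.2 (sub_ne_zero.2 htp)
          positivity
        set d := ‖γ t - p‖ ^ 2 with hdd
        set i := |inner ℝ ν (γ t - p)| with hi
        have hi0 : 0 ≤ i := abs_nonneg _
        have hγc := hγ.continuous
        have c1 : ∀ᶠ x in 𝓝 t, d / 2 < ‖γ x - p‖ ^ 2 :=
          ((hγc.sub continuous_const).norm.pow 2).continuousAt.eventually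
            (lt_mem_nhds (show d / 2 < ‖γ t - p‖ ^ 2 by linarith))
        have c2 : ∀ᶠ x in 𝓝 t, |inner ℝ ν (γ x - p)| < i + 1 :=
          ((continuous_const.inner (hγc.sub continuous_const)).abs).continuousAt.eventually
            (gt_mem_nhds (show |inner ℝ ν (γ t - p)| < i + 1 by linarith))
        refine ⟨_, mem_nhdsWithin_of_mem_nhds (c1.and c2), d / (4 * (i + 1)), by positivity, ?_⟩
        rintro x ⟨h1, h2⟩
        calc 2 * (d / (4 * (i + 1))) * |inner ℝ ν (γ x - p)|
            ≤ 2 * (d / (4 * (i + 1))) * (i + 1) := by gcongr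
          _ = d / 2 := by field_simp; ring
          _ ≤ _ := h1.le
  obtain ⟨r, hr, h⟩ := main
  refine ⟨r, hr, fun t => ?_⟩
  obtain ⟨y, hy, hty⟩ := hper.exists_mem_Ico₀ one_pos t
  rw [hty]
  exact h y (Ico_subset_Icc_self hy)

theorem exists_eq_inner_smul_add_smul (hE : Module.finrank ℝ E = 2) {ν τ : E} (hν : ‖ν‖ = 1)
    (hτ : τ ≠ 0) (hντ : inner ℝ ν τ = 0) (x : E) :
    ∃ c : ℝ, x = (inner ℝ ν x : ℝ) • ν + c • τ := by
  have : Fact (Module.finrank ℝ E = 1 + 1) := ⟨hE⟩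
  have hν0 : ν ≠ 0 := by rintro rfl; simp at hν
  have hfin := Submodule.finrank_orthogonal_span_singleton (𝕜 := ℝ) (n := 1) hν0
  have hτm : τ ∈ (Submodule.span ℝ {ν})ᗮ := Submodule.mem_orthogonal_singleton_iff_inner_right.2 hντ
  have hxm : x - (inner ℝ ν x : ℝ) • ν ∈ (Submodule.span ℝ {ν})ᗮ := by
    rw [Submodule.mem_orthogonal_singleton_iff_inner_right, inner_sub_right, inner_smul_right,
      real_inner_self_eq_norm_sq, hν]
    simp
  obtain ⟨c, hc⟩ := exists_smul_eq_of_finrank_eq_one hfin (x := ⟨τ, hτm⟩)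
    (by simpa [Subtype.ext_iff] using hτ) ⟨_, hxm⟩
  refine ⟨c, ?_⟩
  have : c • τ = x - (inner ℝ ν x : ℝ) • ν := congrArg Subtype.val hc
  rw [this]; abel

end Curves

section Boundary

variable {Γ Γ' Ω : Set Plane} {p ν : Plane}

theorem IsOutwardUnitNormal.inner_deriv_eq_zero (hν : IsOutwardUnitNormal Γ Ω p ν) {γ : ℝ → Plane}
    (hγ : Differentiable ℝ γ) (hrange : range γ = Γ) {t : ℝ} (ht : γ t = p) :
    inner ℝ ν (deriv γ t) = 0 := by
  refine hν.orthogonal (fun s => γ (t + s)) _ (fun s => hrange ▸ mem_range_self _) (by simpa) ?_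
  have h := (hγ (t + 0)).hasDerivAt.comp_const_add t 0
  simpa using h

theorem IsSimpleClosedSmoothCurve.isCompact (hΓ : IsSimpleClosedSmoothCurve Γ) : IsCompact Γ := by
  obtain ⟨γ, hγ, hper, -, -, rfl⟩ := hΓ
  rw [← hper.image_Icc one_pos 0]
  exact isCompact_Icc.image hγ.continuous

theorem IsOutwardUnitNormal.mem_closure (hν : IsOutwardUnitNormal Γ Ω p ν) : p ∈ closure Ω := by
  have ht : Tendsto (fun s : ℝ => p - s • ν) (𝓝[>] 0) (𝓝 p) := by
    have : Continuous fun s : ℝ => p - s • ν := by fun_prop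
    simpa using (this.tendsto 0).mono_left nhdsWithin_le_nhds
  exact mem_closure_of_tendsto ht hν.inside

/-- The interior ball condition at a boundary point `p`; `Γ'` stands for the rest of the boundary.
A small ball `ball (p - ρ • ν) ρ` meets `Ω` and avoids its frontier. -/
theorem IsOutwardUnitNormal.exists_ball_subset (hν : IsOutwardUnitNormal Γ Ω p ν) (hΩ : IsOpen Ω)
    (hΓ : IsSimpleClosedSmoothCurve Γ) (hΓ' : IsClosed Γ') (hp : p ∉ Γ')
    (hfr : frontier Ω ⊆ Γ ∪ Γ') :
    ∃ r > 0, ∀ ρ, 0 < ρ → ρ ≤ r → ball (p - ρ • ν) ρ ⊆ Ω := by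
  obtain ⟨γ, hγ, hper, hreg, -, hrange⟩ := hΓ
  have hγ2 : ContDiff ℝ 2 γ := contDiff_infty.1 hγ 2
  obtain ⟨r₁, hr₁, h₁⟩ := exists_mul_abs_inner_le_norm_sq hγ2 hper hreg
    (fun t ht => hν.inner_deriv_eq_zero (hγ2.differentiable (by norm_num)) hrange ht)
  obtain ⟨ε, hε, hball⟩ := Metric.mem_nhds_iff.1 (hΓ'.isOpen_compl.mem_nhds hp)
  refine ⟨min r₁ (ε / 2), by positivity, fun ρ hρ hρr => ?_⟩
  have hρ₁ : ρ ≤ r₁ := hρr.trans (min_le_left _ _)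
  have hρ₂ : ρ ≤ ε / 2 := hρr.trans (min_le_right _ _)
  have hdisj : ∀ x ∈ ball (p - ρ • ν) ρ, x ∉ frontier Ω := by
    intro x hx hxf
    rw [mem_ball, dist_eq_norm] at hx
    rcases hfr hxf with h | h
    · rw [← hrange] at h
      obtain ⟨t, rfl⟩ := h
      have e1 : γ t - (p - ρ • ν) = (γ t - p) + ρ • ν := by abel
      have e2 : ‖γ t - (p - ρ • ν)‖ ^ 2
          = ‖γ t - p‖ ^ 2 + 2 * (ρ * inner ℝ ν (γ t - p)) + ρ ^ 2 := by
        rw [e1, norm_add_sq_real, inner_smul_right, norm_smul, hν.norm_eq_one, mul_one,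
          Real.norm_eq_abs, sq_abs, real_inner_comm]
      have e3 : ‖γ t - (p - ρ • ν)‖ ^ 2 < ρ ^ 2 := by gcongr
      have e4 := h₁ t
      have e5 : 2 * ρ * |inner ℝ ν (γ t - p)| ≤ 2 * r₁ * |inner ℝ ν (γ t - p)| := by gcongr
      have e6 := mul_le_mul_of_nonneg_left (neg_abs_le (inner ℝ ν (γ t - p))) hρ.le
      linarith
    · refine hball ?_ h
      rw [mem_ball, dist_eq_norm]
      have e1 : x - p = (x - (p - ρ • ν)) - ρ • ν := by abel
      have e2 := norm_sub_le (x - (p - ρ • ν)) (ρ • ν)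
      rw [norm_smul, hν.norm_eq_one, mul_one, Real.norm_of_nonneg hρ.le] at e2
      rw [e1]
      linarith
  have hne : (ball (p - ρ • ν) ρ ∩ Ω).Nonempty := by
    have h1 : ∀ᶠ s : ℝ in 𝓝[>] 0, s ∈ Ioo 0 (2 * ρ) := Ioo_mem_nhdsGT (by linarith)
    obtain ⟨s, hs, hsΩ⟩ := (h1.and hν.inside).exists
    refine ⟨p - s • ν, ?_, hsΩ⟩
    have e1 : p - s • ν - (p - ρ • ν) = (ρ - s) • ν := by rw [sub_smul]; abel
    rw [mem_ball, dist_eq_norm, e1, norm_smul, hν.norm_eq_one, mul_one, Real.norm_eq_abs, abs_lt]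
    constructor <;> linarith [hs.1, hs.2]
  refine (convex_ball (p - ρ • ν) ρ).isPreconnected.subset_left_of_subset_union hΩ
    isClosed_closure.isOpen_compl (disjoint_compl_right.mono_left subset_closure) ?_ hne
  intro x hx
  by_contra h
  rw [mem_union, not_or, notMem_compl_iff] at h
  exact hdisj x hx ⟨h.2, by rw [hΩ.interior_eq]; exact h.1⟩

theorem IsOutwardUnitNormal.mem_closedBall (hν : IsOutwardUnitNormal Γ Ω p ν) {ρ : ℝ}
    (hρ : 0 ≤ ρ) : p ∈ closedBall (p - ρ • ν) ρ := by
  simp [norm_smul, hν.norm_eq_one, abs_of_nonneg hρ]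

theorem IsOutwardUnitNormal.uniqueDiffWithinAt (hν : IsOutwardUnitNormal Γ Ω p ν) {r : ℝ}
    (hr : 0 < r) (hball : ball (p - r • ν) r ⊆ Ω) : UniqueDiffWithinAt ℝ (closure Ω) p := by
  refine (uniqueDiffWithinAt_convex (convex_ball (p - r • ν) r) ?_ ?_).mono
    (hball.trans subset_closure)
  · rw [isOpen_ball.interior_eq]
    exact nonempty_ball.2 hr
  · rw [closure_ball _ hr.ne']
    exact hν.mem_closedBall hr.le

/-- On a boundary curve on which `u` is constant the tangential derivative vanishes, so the gradient of
`u` has the length of its normal derivative. -/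
theorem norm_fderivWithin_sq_eq_of_hasNormalDeriv {u : Plane → ℝ} {a k : ℝ}
    (hΓ : IsSimpleClosedSmoothCurve Γ) (hsub : Γ ⊆ closure Ω) (hp : p ∈ Γ)
    (hu : DifferentiableWithinAt ℝ u (closure Ω) p) (hconst : ∀ q ∈ Γ, u q = a)
    (hk : HasNormalDeriv Γ Ω u p k) : ‖fderivWithin ℝ u (closure Ω) p‖ ^ 2 = k ^ 2 := by
  obtain ⟨ν, hν, hder⟩ := hk
  obtain ⟨γ, hγ, -, hreg, -, hrange⟩ := hΓ
  have hγd : Differentiable ℝ γ := hγ.differentiable (by simp)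
  obtain ⟨t, rfl⟩ : p ∈ range γ := hrange ▸ hp
  set D := fderivWithin ℝ u (closure Ω) (γ t)
  have hD : HasFDerivWithinAt u D (closure Ω) (γ t) := hu.hasFDerivWithinAt
  have hDτ : D (deriv γ t) = 0 := by
    have h1 : HasDerivAt (u ∘ γ) (D (deriv γ t)) t :=
      hD.comp_hasDerivAt t (hγd t).hasDerivAt
        (Eventually.of_forall fun s => hsub (hrange ▸ mem_range_self s))
    have h2 : u ∘ γ = fun _ => a := by
      funext s; exact hconst _ (hrange ▸ mem_range_self s)
    rw [h2] at h1
    exact h1.unique (hasDerivAt_const t a)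
  have hDν : D ν = k := by
    have hline : HasDerivWithinAt (fun s : ℝ => γ t + s • ν) ν (Iic 0) 0 := by
      simpa using (((hasDerivAt_id (0 : ℝ)).smul_const ν).const_add (γ t)).hasDerivWithinAt
    have hev : ∀ᶠ s : ℝ in 𝓝[Iic 0] 0, γ t + s • ν ∈ closure Ω := by
      obtain ⟨δ, hδ, hin⟩ := mem_nhdsGT_iff_exists_Ioo_subset.1 hν.inside
      have : Ioi (-δ) ∈ 𝓝 (0 : ℝ) := Ioi_mem_nhds (by simpa using hδ)
      filter_upwards [mem_nhdsWithin_of_mem_nhds this, self_mem_nhdsWithin] with s hs hs0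
      rcases eq_or_lt_of_le (show s ≤ 0 from hs0) with h | h
      · rw [h, zero_smul, add_zero]; exact hν.mem_closure
      · have := @hin (-s) ⟨by linarith, by simpa using neg_lt.1 hs⟩
        simp only [mem_ofPred_eq, neg_smul, sub_neg_eq_add] at this
        exact subset_closure this
    have hD' : HasFDerivWithinAt u D (closure Ω) ((fun s : ℝ => γ t + s • ν) 0) := by simpa using hD
    -- replace the half-line by the part of it that lies in the closure of `Ω`
    have h1 : HasDerivWithinAt (u ∘ fun s : ℝ => γ t + s • ν) (D ν)
        (Iic 0 ∩ {s | γ t + s • ν ∈ closure Ω}) 0 :=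
      hD'.comp_hasDerivWithinAt 0 (hline.mono inter_subset_left) fun s hs => hs.2
    have h2 : HasDerivWithinAt (u ∘ fun s : ℝ => γ t + s • ν) (D ν) (Iic 0) 0 :=
      (hasDerivWithinAt_inter' hev).1 h1
    exact (uniqueDiffWithinAt_Iic 0).eq_deriv _ h2 hder
  have hDeq : D = k • innerSL ℝ ν := by
    ext x
    obtain ⟨c, hc⟩ := exists_eq_inner_smul_add_smul (by simp) hν.norm_eq_one (hreg t)
      (hν.inner_deriv_eq_zero hγd hrange rfl) x
    conv_lhs => rw [hc]
    simp [hDτ, hDν]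
    ring
  rw [hDeq, norm_smul, innerSL_apply_norm, hν.norm_eq_one, mul_one, Real.norm_eq_abs, sq_abs]

end Boundary

/-! ### One-sided derivatives, exit times and the radial comparison function -/

section Auxiliary

/-- The form in which a linear lower bound in the inward direction bounds a normal derivative. -/
theorem HasDerivWithinAt.le_neg_of_eventually_le {f : ℝ → ℝ} {k c : ℝ}
    (hf : HasDerivWithinAt f k (Iic 0) 0) (h : ∀ᶠ s in 𝓝[>] (0 : ℝ), f 0 + c * s ≤ f (-s)) :
    k ≤ -c := by
  have hg : HasDerivWithinAt (fun s => f (-s)) (-k) (Ioi 0) 0 := by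
    have h1 : HasDerivWithinAt (fun s : ℝ => -s) (-1) (Ioi 0) 0 :=
      (hasDerivAt_neg 0).hasDerivWithinAt
    have h2 : HasDerivWithinAt f k (Iic 0) (-0) := by simpa using hf
    have := h2.scomp (0 : ℝ) h1 fun s hs => by
      simpa using (show (0 : ℝ) < s from hs).le
    exact this.congr_deriv (by simp)
  have ht := (hasDerivWithinAt_iff_tendsto_slope' self_notMem_Ioi).1 hg
  have : c ≤ -k := by
    refine ge_of_tendsto ht ?_
    filter_upwards [h, self_mem_nhdsWithin] with s hs hs0
    have hs0' : 0 < s := hs0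
    rw [slope_def_field, sub_zero, le_div_iff₀ hs0', neg_zero]
    linarith
  linarith

theorem exists_exit_time {E : Type*} [NormedAddCommGroup E] [NormedSpace ℝ E] {S : Set E}
    (hS : IsOpen S) (hb : Bornology.IsBounded S) {x v : E} (hx : x ∈ S) (hv : ‖v‖ = 1) :
    ∃ τ : ℝ, 0 < τ ∧ (∀ t ∈ Ico 0 τ, x + t • v ∈ S) ∧ x + τ • v ∈ frontier S := by
  have hc : Continuous fun t : ℝ => x + t • v := by fun_prop
  set T : Set ℝ := Ici 0 ∩ (fun t : ℝ => x + t • v) ⁻¹' Sᶜ with hT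
  have hTc : IsClosed T := isClosed_Ici.inter (hS.isClosed_compl.preimage hc)
  obtain ⟨K, hK⟩ := hb.exists_norm_le
  have hK0 : 0 ≤ K := (norm_nonneg x).trans (hK x hx)
  have hTne : T.Nonempty := by
    refine ⟨2 * K + 1, by simp only [mem_Ici]; linarith, fun hmem => ?_⟩
    have h1 := hK _ hmem
    have h2 := norm_sub_norm_le ((2 * K + 1) • v) (-x)
    rw [sub_neg_eq_add, norm_neg, norm_smul, hv, mul_one, add_comm _ x,
      Real.norm_of_nonneg (by linarith)] at h2
    linarith [hK x hx]
  have hTb : BddBelow T := ⟨0, fun t ht => ht.1⟩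
  have hmem := hTc.csInf_mem hTne hTb
  set τ := sInf T
  have hτ0 : τ ≠ 0 := by
    intro h0
    have := hmem.2
    rw [h0] at this
    simp at this
    exact this hx
  have hτ : 0 < τ := lt_of_le_of_ne hmem.1 (Ne.symm hτ0)
  have hin : ∀ t ∈ Ico 0 τ, x + t • v ∈ S := by
    intro t ht
    by_contra hn
    exact absurd (csInf_le hTb ⟨ht.1, hn⟩) (not_le.2 ht.2)
  refine ⟨τ, hτ, hin, ?_, by rw [hS.interior_eq]; exact hmem.2⟩
  have ht : Tendsto (fun t : ℝ => x + t • v) (𝓝[<] τ) (𝓝 (x + τ • v)) :=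
    (hc.tendsto τ).mono_left nhdsWithin_le_nhds
  refine mem_closure_of_tendsto ht ?_
  filter_upwards [Ioo_mem_nhdsLT hτ] with t ht using hin t ⟨ht.1.le, ht.2⟩

/-- The bound `|∇u|² + 4 u ≤ M` says that `√(M - 4 u)` has gradient at most `2`, hence changes by at most
`2 τ` along a segment of length `τ`. -/
theorem abs_sqrt_sub_sqrt_le_of_gradient_bound {E : Type*} [NormedAddCommGroup E]
    [NormedSpace ℝ E] {u : E → ℝ} {M τ : ℝ} {x v : E} (hv : ‖v‖ = 1) (hτ : 0 ≤ τ)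
    (hc : ContinuousOn (fun t : ℝ => u (x + t • v)) (Icc 0 τ))
    (hd : ∀ t ∈ Ico 0 τ, DifferentiableAt ℝ u (x + t • v))
    (hpos : ∀ t ∈ Ico 0 τ, 4 * u (x + t • v) < M)
    (hP : ∀ t ∈ Ico 0 τ, ‖fderiv ℝ u (x + t • v)‖ ^ 2 + 4 * u (x + t • v) ≤ M) :
    |√(M - 4 * u (x + τ • v)) - √(M - 4 * u x)| ≤ 2 * τ := by
  have key := norm_image_sub_le_of_norm_deriv_right_le_segment
    (f := fun t : ℝ => √(M - 4 * u (x + t • v))) (a := 0) (b := τ) (C := 2)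
    (f' := fun t => -(4 * fderiv ℝ u (x + t • v) v) / (2 * √(M - 4 * u (x + t • v))))
    (continuousOn_const.sub (continuousOn_const.mul hc)).sqrt ?_ ?_ τ ⟨hτ, le_rfl⟩
  · simpa using key
  · intro t ht
    have hline : HasDerivAt (fun t : ℝ => x + t • v) v t := by
      simpa using ((hasDerivAt_id t).smul_const v).const_add x
    have h1 := ((hd t ht).hasFDerivAt.comp_hasDerivAt t hline).const_mul 4
    have h2 := (h1.const_sub M).sqrt (by have := hpos t ht; simp only [Function.comp]; linarith)
    exact h2.hasDerivWithinAt
  · intro t ht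
    have h1 : 0 < M - 4 * u (x + t • v) := by linarith [hpos t ht]
    have h2 : ‖fderiv ℝ u (x + t • v)‖ ≤ √(M - 4 * u (x + t • v)) :=
      Real.le_sqrt_of_sq_le (by linarith [hP t ht])
    have h3 := (fderiv ℝ u (x + t • v)).le_opNorm v
    rw [hv, mul_one, Real.norm_eq_abs] at h3
    have h4 : 0 < √(M - 4 * u (x + t • v)) := Real.sqrt_pos.2 h1
    rw [Real.norm_eq_abs, abs_div, abs_neg, abs_mul, abs_of_pos (by positivity : (0 : ℝ) < 4),
      abs_of_pos (by positivity : 0 < 2 * √(M - 4 * u (x + t • v))), div_le_iff₀ (by positivity)]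
    linarith

theorem laplacian_const_add_mul_norm_sub_norm_sq {E : Type*} [NormedAddCommGroup E]
    [InnerProductSpace ℝ E] [FiniteDimensional ℝ E] (hE : Module.finrank ℝ E = 2) (C k : ℝ) {x : E}
    (hx : x ≠ 0) : Δ (fun y : E => C + k * ‖y‖ - ‖y‖ ^ 2) x = k / ‖x‖ - 4 := by
  have hn : 0 < ‖x‖ := norm_pos_iff.2 hx
  have hρ : ‖x - 0‖ ^ 2 ≠ 0 := by simpa using hx
  have hs : √(‖x - 0‖ ^ 2) = ‖x‖ := by rw [sub_zero, Real.sqrt_sq hn.le]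
  have := laplacian_radial hE (h := fun ρ => C + k * √ρ - ρ)
    (h' := fun ρ => k * (1 / (2 * √ρ)) - 1) (h'' := -k / (4 * ‖x‖ ^ 3)) (c := 0) (x := x)
    ?_ ?_ ?_
  · simp only [sub_zero, Real.sqrt_sq (norm_nonneg _)] at this
    rw [this]
    field_simp
    ring
  · have h1 : ContDiffAt ℝ 2 Real.sqrt (‖x - 0‖ ^ 2) := Real.contDiffAt_sqrt hρ
    exact (contDiffAt_const.add (contDiffAt_const.mul h1)).sub contDiffAt_id
  · filter_upwards [eventually_ne_nhds hρ] with ρ hρ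
    exact (((Real.hasDerivAt_sqrt hρ).const_mul k).const_add C).sub (hasDerivAt_id ρ)
  · have h1 := ((Real.hasDerivAt_sqrt hρ).const_mul 2).inv (by rw [hs]; positivity)
    have h2 := (h1.const_mul k).sub_const 1
    simp only [hs] at h2
    refine (h2.congr_of_eventuallyEq (Eventually.of_forall fun y => by simp)).congr_deriv ?_
    field_simp
    norm_num

end Auxiliary

/-! ### Comparison with a radial function at a farthest boundary point -/

namespace IsSerrinSolution

variable {Ei Eo : Set Plane} {u : Plane → ℝ} {a b α β : ℝ}

theorem isOpen_ringRegion (h : IsSerrinSolution Ei Eo u a b α β) : IsOpen (ringRegion Ei Eo) :=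
  h.outer_domain.isOpen.sdiff isClosed_closure

theorem isBounded_ringRegion (h : IsSerrinSolution Ei Eo u a b α β) :
    Bornology.IsBounded (ringRegion Ei Eo) :=
  h.outer_domain.isBounded.subset sdiff_subset

theorem frontier_ringRegion_subset (h : IsSerrinSolution Ei Eo u a b α β) :
    frontier (ringRegion Ei Eo) ⊆ frontier Ei ∪ frontier Eo := by
  rintro x ⟨hx, hxi⟩
  rw [h.isOpen_ringRegion.interior_eq] at hxi
  by_cases hxo : x ∈ Eo
  · left
    have hxc : x ∈ closure Ei := by
      by_contra hn
      exact hxi ⟨hxo, hn⟩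
    refine ⟨hxc, fun hin => ?_⟩
    obtain ⟨y, hy, hy'⟩ := mem_closure_iff.1 hx _ isOpen_interior hin
    exact hy'.2 (subset_closure (interior_subset hy))
  · right
    exact ⟨closure_mono sdiff_subset hx, by rwa [h.outer_domain.isOpen.interior_eq]⟩

theorem notMem_closure_of_mem_frontier (h : IsSerrinSolution Ei Eo u a b α β) {p : Plane}
    (hp : p ∈ frontier Eo) : p ∉ closure Ei := by
  intro hn
  have := hp.2
  rw [h.outer_domain.isOpen.interior_eq] at this
  exact this (h.closure_subset hn)

theorem exists_ball_subset_outer (h : IsSerrinSolution Ei Eo u a b α β) {p ν : Plane}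
    (hp : p ∈ frontier Eo) (hν : IsOutwardUnitNormal (frontier Eo) (ringRegion Ei Eo) p ν) :
    ∃ r > 0, ∀ ρ, 0 < ρ → ρ ≤ r → ball (p - ρ • ν) ρ ⊆ ringRegion Ei Eo :=
  hν.exists_ball_subset h.isOpen_ringRegion h.outer_domain.boundary isClosed_frontier
    (fun hn => h.notMem_closure_of_mem_frontier hp (frontier_subset_closure hn))
    (by rw [union_comm]; exact h.frontier_ringRegion_subset)

theorem exists_ball_subset_inner (h : IsSerrinSolution Ei Eo u a b α β) {p ν : Plane}
    (hp : p ∈ frontier Ei) (hν : IsOutwardUnitNormal (frontier Ei) (ringRegion Ei Eo) p ν) :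
    ∃ r > 0, ∀ ρ, 0 < ρ → ρ ≤ r → ball (p - ρ • ν) ρ ⊆ ringRegion Ei Eo :=
  hν.exists_ball_subset h.isOpen_ringRegion h.inner_domain.boundary isClosed_frontier
    (fun hn => h.notMem_closure_of_mem_frontier hn (frontier_subset_closure hp))
    h.frontier_ringRegion_subset

theorem uniqueDiffOn (h : IsSerrinSolution Ei Eo u a b α β) :
    UniqueDiffOn ℝ (closure (ringRegion Ei Eo)) := by
  intro x hx
  by_cases hxΩ : x ∈ ringRegion Ei Eo
  · exact (h.isOpen_ringRegion.uniqueDiffWithinAt hxΩ).mono subset_closure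
  · rcases h.frontier_ringRegion_subset ⟨hx, by rwa [h.isOpen_ringRegion.interior_eq]⟩ with hp | hp
    · obtain ⟨ν, hν, -⟩ := h.inner_normal x hp
      obtain ⟨r, hr, hball⟩ := h.exists_ball_subset_inner hp hν
      exact hν.uniqueDiffWithinAt hr (hball r hr le_rfl)
    · obtain ⟨ν, hν, -⟩ := h.outer_normal x hp
      obtain ⟨r, hr, hball⟩ := h.exists_ball_subset_outer hp hν
      exact hν.uniqueDiffWithinAt hr (hball r hr le_rfl)

theorem contDiffAt (h : IsSerrinSolution Ei Eo u a b α β) {x : Plane}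
    (hx : x ∈ ringRegion Ei Eo) : ContDiffAt ℝ 2 u x :=
  (h.contDiffOn_interior x hx).contDiffAt (h.isOpen_ringRegion.mem_nhds hx)

theorem norm_fderiv_sq_add_le (h : IsSerrinSolution Ei Eo u a b α β) {M : ℝ}
    (hi : 4 * a + α ^ 2 ≤ M) (ho : 4 * b + β ^ 2 ≤ M)
    (hu : ∀ x ∈ ringRegion Ei Eo, 4 * u x ≤ M) :
    ∀ x ∈ ringRegion Ei Eo, ‖fderiv ℝ u x‖ ^ 2 + 4 * u x ≤ M := by
  set Ω := ringRegion Ei Eo with hΩ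
  have hfd : ∀ x ∈ Ω, fderivWithin ℝ u (closure Ω) x = fderiv ℝ u x := fun x hx =>
    fderivWithin_of_mem_nhds (mem_of_superset (h.isOpen_ringRegion.mem_nhds hx) subset_closure)
  have hdiff := h.contDiffOn_closure.differentiableOn (by simp)
  have key := _root_.norm_fderiv_sq_add_le (by simp) h.isOpen_ringRegion h.isBounded_ringRegion
    (P := fun x => ‖fderivWithin ℝ u (closure Ω) x‖ ^ 2 + 4 * u x) (M := M)
    h.contDiffOn_interior h.laplacian_eq
    (((h.contDiffOn_closure.continuousOn_fderivWithin h.uniqueDiffOn (by simp)).norm.pow 2).add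
      (continuousOn_const.mul h.contDiffOn_closure.continuousOn))
    (fun x hx => by simp only [hfd x hx]) ?_ hu
  · intro x hx
    have := key x hx
    rwa [hfd x hx] at this
  · intro p hp
    have hpc : p ∈ closure Ω := hp.1
    rcases h.frontier_ringRegion_subset hp with hp | hp
    · have := norm_fderivWithin_sq_eq_of_hasNormalDeriv h.inner_domain.boundary
        (fun q hq => by obtain ⟨ν, hν, -⟩ := h.inner_normal q hq; exact hν.mem_closure) hp
        (hdiff p hpc) h.inner_value (h.inner_normal p hp)
      simp only [h.inner_value p hp]
      linarith
    · have := norm_fderivWithin_sq_eq_of_hasNormalDeriv h.outer_domain.boundary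
        (fun q hq => by obtain ⟨ν, hν, -⟩ := h.outer_normal q hq; exact hν.mem_closure) hp
        (hdiff p hpc) h.outer_value (h.outer_normal p hp)
      simp only [h.outer_value p hp]
      linarith

/-- Near a point `p` of the outer curve at maximal distance from the origin, the distance to the
outer curve is at most `‖p‖ - ‖x‖`, as one sees by moving radially outwards. This turns the gradient bound
into a bound of `u` by radial functions. -/
theorem exists_abs_sqrt_sub_abs_le (h : IsSerrinSolution Ei Eo u a b α β) {p : Plane}
    (hp : p ∈ frontier Eo) (hp0 : p ≠ 0) (hpmax : ∀ q ∈ frontier Eo, ‖q‖ ≤ ‖p‖)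
    (hP : ∀ x ∈ ringRegion Ei Eo, ‖fderiv ℝ u x‖ ^ 2 + 4 * u x ≤ 4 * b + β ^ 2)
    (hpos : ∀ᶠ x in 𝓝 p, x ∈ ringRegion Ei Eo → 4 * u x < 4 * b + β ^ 2) :
    ∀ᶠ x in 𝓝 p, x ∈ ringRegion Ei Eo → 0 < ‖x‖ ∧ ‖x‖ < ‖p‖ ∧
      |√(4 * b + β ^ 2 - 4 * u x) - (|β|)| ≤ 2 * (‖p‖ - ‖x‖) := by
  obtain ⟨δ, hδ, hball⟩ := Metric.mem_nhds_iff.1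
    (hpos.and (isClosed_closure.isOpen_compl.mem_nhds (h.notMem_closure_of_mem_frontier hp)))
  have hR : 0 < ‖p‖ := norm_pos_iff.2 hp0
  filter_upwards [ball_mem_nhds p (half_pos hδ), ball_mem_nhds p hR] with x hx hx' hxΩ
  rw [mem_ball, dist_eq_norm] at hx hx'
  have hn : ‖p‖ - ‖x‖ ≤ ‖x - p‖ := by rw [norm_sub_rev]; exact norm_sub_norm_le p x
  have hxpos : 0 < ‖x‖ := by linarith
  obtain ⟨τ, hτ, hin, hout⟩ := exists_exit_time h.outer_domain.isOpen h.outer_domain.isBounded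
    hxΩ.1 (v := ‖x‖⁻¹ • x) (by rw [norm_smul, norm_inv, norm_norm]; field_simp)
  set v := ‖x‖⁻¹ • x with hv
  have hv1 : ‖v‖ = 1 := by rw [hv, norm_smul, norm_inv, norm_norm]; field_simp
  have hxτ : ‖x + τ • v‖ = ‖x‖ + τ := by
    have hxv : x + τ • v = (‖x‖ + τ) • v := by
      rw [add_smul, hv, smul_smul ‖x‖, mul_inv_cancel₀ hxpos.ne', one_smul]
    rw [hxv, norm_smul, hv1, mul_one, Real.norm_of_nonneg (by positivity)]
  have hτR : τ ≤ ‖p‖ - ‖x‖ := by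
    have := hpmax _ hout
    linarith
  have hnear : ∀ t ∈ Icc 0 τ, x + t • v ∈ ball p δ := by
    intro t ht
    rw [mem_ball, dist_eq_norm]
    have e1 : x + t • v - p = (x - p) + t • v := by abel
    have e2 := norm_add_le (x - p) (t • v)
    rw [norm_smul, hv1, mul_one, Real.norm_of_nonneg ht.1] at e2
    rw [e1]
    linarith [ht.2]
  have hinΩ : ∀ t ∈ Ico 0 τ, x + t • v ∈ ringRegion Ei Eo := fun t ht =>
    ⟨hin t ht, (hball (hnear t ⟨ht.1, ht.2.le⟩)).2⟩
  have hcl : ∀ t ∈ Icc 0 τ, x + t • v ∈ closure (ringRegion Ei Eo) := by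
    intro t ht
    rcases eq_or_lt_of_le ht.2 with rfl | hlt
    · obtain ⟨ν, hν, -⟩ := h.outer_normal _ hout
      exact hν.mem_closure
    · exact subset_closure (hinΩ t ⟨ht.1, hlt⟩)
  have key := abs_sqrt_sub_sqrt_le_of_gradient_bound (u := u) (M := 4 * b + β ^ 2) hv1 hτ.le
    (h.contDiffOn_closure.continuousOn.comp (by fun_prop) hcl)
    (fun t ht => (h.contDiffAt (hinΩ t ht)).differentiableAt (by simp))
    (fun t ht => (hball (hnear t ⟨ht.1, ht.2.le⟩)).1 (hinΩ t ht))
    (fun t ht => hP _ (hinΩ t ht))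
  rw [h.outer_value _ hout, add_sub_cancel_left, Real.sqrt_sq_eq_abs, abs_sub_comm] at key
  exact ⟨hxpos, by linarith, by linarith⟩

/-- At a farthest point from the origin the outward normal is radial. -/
theorem eq_norm_smul_of_forall_norm_le (h : IsSerrinSolution Ei Eo u a b α β) {p ν : Plane}
    (hp : p ∈ frontier Eo) (hpmax : ∀ q ∈ frontier Eo, ‖q‖ ≤ ‖p‖)
    (hν : IsOutwardUnitNormal (frontier Eo) (ringRegion Ei Eo) p ν) : p = ‖p‖ • ν := by
  obtain ⟨γ, hγ, -, hreg, -, hrange⟩ := h.outer_domain.boundary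
  have hγd : Differentiable ℝ γ := hγ.differentiable (by simp)
  obtain ⟨t, rfl⟩ : p ∈ range γ := hrange ▸ hp
  have hντ := hν.inner_deriv_eq_zero hγd hrange rfl
  have hpτ : inner ℝ (γ t) (deriv γ t) = 0 := by
    have hmax : IsLocalMax (fun s => ‖γ s‖ ^ 2) t := Eventually.of_forall fun s => by
      have := hpmax (γ s) (hrange ▸ mem_range_self s)
      simp only
      gcongr
    have := hmax.hasDerivAt_eq_zero (hγd t).hasDerivAt.norm_sq
    linarith
  obtain ⟨c, hc⟩ := exists_eq_inner_smul_add_smul (by simp) hν.norm_eq_one (hreg t) hντ (γ t)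
  have hc0 : c = 0 := by
    rw [hc, inner_add_left, inner_smul_left, inner_smul_left, hντ] at hpτ
    simpa [hreg t] using hpτ
  rw [hc0, zero_smul, add_zero] at hc
  set k : ℝ := inner ℝ ν (γ t)
  have hk : ‖γ t‖ = |k| := by rw [hc, norm_smul, hν.norm_eq_one, mul_one, Real.norm_eq_abs]
  have hk0 : 0 ≤ k := by
    by_contra! hneg
    -- otherwise the inward direction leads away from the origin, hence out of `Eo`
    obtain ⟨s, hs0, hs⟩ := ((show ∀ᶠ s : ℝ in 𝓝[>] 0, 0 < s from self_mem_nhdsWithin).and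
      hν.inside).exists
    obtain ⟨τ, hτ, -, hout⟩ := exists_exit_time h.outer_domain.isOpen h.outer_domain.isBounded
      hs.1 (v := -ν) (by rw [norm_neg, hν.norm_eq_one])
    have h1 := hpmax _ hout
    have h2 : γ t - s • ν + τ • -ν = (k - s - τ) • ν := by
      rw [hc, sub_smul, sub_smul, smul_neg]; abel
    rw [h2, norm_smul, hν.norm_eq_one, mul_one, Real.norm_eq_abs, hk, abs_of_neg hneg,
      abs_of_neg (by linarith)] at h1
    linarith
  rw [hk, abs_of_nonneg hk0]
  exact hc

/-- The function `u` cannot be compared near a farthest point `p` with the radial function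
`f = b - β (‖p‖ - ‖x‖) - (‖p‖ - ‖x‖)²`, which has the same value and normal derivative at `p`: if `σ (u - f)` is
nonnegative and strictly superharmonic in a ball touching the boundary at `p`, then Hopf's lemma is
violated. The hypothesis `hlap` expresses `Δ (σ (u - f)) < 0`. -/
theorem false_of_touching (h : IsSerrinSolution Ei Eo u a b α β) {p ν : Plane} {σ ρ : ℝ}
    (hp : p ∈ frontier Eo) (hp0 : p ≠ 0) (hpν : p = ‖p‖ • ν)
    (hν : IsOutwardUnitNormal (frontier Eo) (ringRegion Ei Eo) p ν)
    (hder : HasDerivWithinAt (fun s : ℝ => u (p + s • ν)) β (Iic 0) 0)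
    (hρ : 0 < ρ) (hball : ball (p - ρ • ν) ρ ⊆ ringRegion Ei Eo)
    (hne : ∀ x ∈ ball (p - ρ • ν) ρ, x ≠ 0)
    (hnonneg : ∀ x ∈ ball (p - ρ • ν) ρ,
      0 ≤ σ * (u x - (b - β * (‖p‖ - ‖x‖) - (‖p‖ - ‖x‖) ^ 2)))
    (hlap : ∀ x ∈ ball (p - ρ • ν) ρ, σ * (2 - (β + 2 * ‖p‖) / ‖x‖) < 0) : False := by
  set R := ‖p‖ with hR
  have hRpos : 0 < R := norm_pos_iff.2 hp0
  set f : Plane → ℝ := fun y => (b - β * R - R ^ 2) + (β + 2 * R) * ‖y‖ - ‖y‖ ^ 2 with hf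
  have hfC : ∀ x : Plane, x ≠ 0 → ContDiffAt ℝ 2 f x := fun x hx =>
    (contDiffAt_const.add (contDiffAt_const.mul (contDiffAt_norm ℝ hx))).sub
      (contDiffAt_id.norm_sq ℝ)
  have hcl : closedBall (p - ρ • ν) ρ ⊆ closure (ringRegion Ei Eo) := by
    rw [← closure_ball _ hρ.ne']
    exact closure_mono hball
  obtain ⟨c, hc, hlow⟩ := exists_linear_lower_bound_of_laplacian_neg (by simp) (w := σ • (u - f))
    hρ hν.norm_eq_one
    (((h.contDiffOn_closure.continuousOn.mono hcl).sub (by fun_prop)).const_smul σ)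
    (fun x hx => ((h.contDiffAt (hball hx)).sub (hfC x (hne x hx))).const_smul σ)
    (fun x hx => by
      have hd : ContDiffAt ℝ 2 (u - f) x := (h.contDiffAt (hball hx)).sub (hfC x (hne x hx))
      rw [laplacian_smul σ hd,
        (h.contDiffAt (hball hx)).laplacian_sub (hfC x (hne x hx)), h.laplacian_eq x (hball hx),
        laplacian_const_add_mul_norm_sub_norm_sq (by simp) _ _ (hne x hx), smul_eq_mul]
      refine lt_of_eq_of_lt ?_ (hlap x hx)
      ring)
    (fun x hx => by
      refine (hnonneg x hx).trans_eq ?_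
      simp only [hf, Pi.smul_apply, Pi.sub_apply, smul_eq_mul]
      ring)
  have hfd : HasDerivWithinAt (fun s : ℝ => f (p + s • ν)) β (Iic 0) 0 := by
    have h1 : HasDerivAt (fun s : ℝ => b + β * s - s ^ 2) β 0 := by
      have := (((hasDerivAt_id (0 : ℝ)).const_mul β).const_add b).sub (hasDerivAt_pow 2 (0 : ℝ))
      exact this.congr_deriv (by simp)
    refine (h1.congr_of_eventuallyEq ?_).hasDerivWithinAt
    filter_upwards [lt_mem_nhds (show -R < 0 by linarith)] with s hs
    have h2 : p + s • ν = (R + s) • ν := by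
      conv_lhs => rw [hpν]
      rw [add_smul]
    have h3 : ‖p + s • ν‖ = R + s := by
      rw [h2, norm_smul, hν.norm_eq_one, mul_one, Real.norm_of_nonneg (by linarith)]
    simp only [hf, h3]
    ring
  have hwd : HasDerivWithinAt (fun s : ℝ => σ * (u (p + s • ν) - f (p + s • ν))) 0 (Iic 0) 0 :=
    ((hder.sub hfd).const_mul σ).congr_deriv (by ring)
  have hz : σ * (u (p + (0 : ℝ) • ν) - f (p + (0 : ℝ) • ν)) = 0 := by
    rw [zero_smul, add_zero, h.outer_value p hp]
    simp only [hf]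
    ring
  have := hwd.le_neg_of_eventually_le (c := c) (by
    filter_upwards [Ioo_mem_nhdsGT (half_pos hρ)] with s hs
    have := hlow s hs.1.le hs.2.le
    rw [hz, zero_add, neg_smul, ← sub_eq_add_neg]
    simpa using this)
  linarith

theorem exists_farthest_point (h : IsSerrinSolution Ei Eo u a b α β) :
    ∃ p ∈ frontier Eo, p ≠ 0 ∧ ∀ q ∈ frontier Eo, ‖q‖ ≤ ‖p‖ := by
  have hne : (frontier Eo).Nonempty := by
    obtain ⟨γ, -, -, -, -, hrange⟩ := h.outer_domain.boundary
    exact ⟨γ 0, hrange ▸ mem_range_self 0⟩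
  obtain ⟨p, hp, hmax⟩ := h.outer_domain.boundary.isCompact.exists_isMaxOn hne
    continuous_norm.continuousOn
  refine ⟨p, hp, ?_, fun q hq => hmax hq⟩
  -- otherwise the regular curve would be reduced to the origin
  rintro rfl
  obtain ⟨γ, hγ, -, hreg, -, hrange⟩ := h.outer_domain.boundary
  have h0 : ∀ s, γ s = 0 := fun s => by
    simpa using hmax (hrange ▸ mem_range_self s)
  refine hreg 0 ?_
  rw [funext h0]
  simp

end IsSerrinSolution

/-! ### Signs and the strict comparison -/

theorem HasNormalDeriv.nonneg_of_forall_le {u : Plane → ℝ} {Γ Ω : Set Plane} {p : Plane} {k : ℝ} (hk : HasNormalDeriv Γ Ω u p k)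
    (hle : ∀ x ∈ Ω, u x ≤ u p) : 0 ≤ k := by
  obtain ⟨ν, hν, hder⟩ := hk
  have := hder.neg.le_neg_of_eventually_le (c := 0) (by
    filter_upwards [hν.inside] with s hs
    have := hle _ hs
    simpa [← sub_eq_add_neg] using this)
  linarith

namespace IsSerrinSolution

variable {Ei Eo : Set Plane} {u : Plane → ℝ} {a b α β : ℝ}

/-- Hopf's lemma for `u`: at a strict boundary minimum the outward normal derivative is negative. -/
theorem normalDeriv_neg (h : IsSerrinSolution Ei Eo u a b α β) {Γ : Set Plane} {p : Plane} {k : ℝ}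
    (hk : HasNormalDeriv Γ (ringRegion Ei Eo) u p k)
    (hball : ∀ ν, IsOutwardUnitNormal Γ (ringRegion Ei Eo) p ν →
      ∃ r > 0, ∀ ρ, 0 < ρ → ρ ≤ r → ball (p - ρ • ν) ρ ⊆ ringRegion Ei Eo)
    (hlt : ∀ x ∈ ringRegion Ei Eo, u p < u x) : k < 0 := by
  obtain ⟨ν, hν, hder⟩ := hk
  obtain ⟨r, hr, hsub⟩ := hball ν hν
  replace hsub := hsub r hr le_rfl
  have hcl : closedBall (p - r • ν) r ⊆ closure (ringRegion Ei Eo) := by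
    rw [← closure_ball _ hr.ne']
    exact closure_mono hsub
  obtain ⟨c, hc, hlow⟩ := exists_linear_lower_bound_of_laplacian_neg (by simp)
    (w := u - fun _ => u p) hr hν.norm_eq_one
    ((h.contDiffOn_closure.continuousOn.mono hcl).sub continuousOn_const)
    (fun x hx => (h.contDiffAt (hsub hx)).sub contDiffAt_const)
    (fun x hx => by
      rw [(h.contDiffAt (hsub hx)).laplacian_sub contDiffAt_const, h.laplacian_eq x (hsub hx)]
      simp)
    (fun x hx => by simpa using (hlt x (hsub hx)).le)
  have := hder.le_neg_of_eventually_le (c := c) (by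
    filter_upwards [Ioo_mem_nhdsGT (half_pos hr)] with s hs
    have := hlow s hs.1.le hs.2.le
    simp only [Pi.sub_apply] at this
    rw [zero_smul, add_zero, neg_smul, ← sub_eq_add_neg]
    linarith)
  linarith

theorem exists_mem_frontier_inner (h : IsSerrinSolution Ei Eo u a b α β) :
    ∃ p, p ∈ frontier Ei := by
  obtain ⟨γ, -, -, -, -, hrange⟩ := h.inner_domain.boundary
  exact ⟨γ 0, hrange ▸ mem_range_self 0⟩

/-- The strict comparison of the two boundary values of the `P`-function. If it failed, the
`P`-function would be at most `4 b + β²`, which near a farthest point of the outer curve gives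
`u ≥ f` when `β ≥ 0` and `u ≤ f` when `β < 0`, with `f` the radial function of
`IsSerrinSolution.false_of_touching`. -/
theorem pFunction_lt (h : IsSerrinSolution Ei Eo u a b α β)
    (hcase : (∀ x ∈ ringRegion Ei Eo, u x < b) ∧ 0 ≤ β ∨
      (∀ x ∈ ringRegion Ei Eo, u x < a) ∧ β < 0) :
    4 * b + β ^ 2 < 4 * a + α ^ 2 := by
  by_contra! hM
  have hP := h.norm_fderiv_sq_add_le hM le_rfl (fun x hx => by
    rcases hcase with ⟨h1, -⟩ | ⟨h1, -⟩
    · nlinarith [h1 x hx, sq_nonneg β]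
    · nlinarith [h1 x hx, sq_nonneg α])
  obtain ⟨p, hp, hp0, hpmax⟩ := h.exists_farthest_point
  obtain ⟨ν, hν, hder⟩ := h.outer_normal p hp
  have hpν := h.eq_norm_smul_of_forall_norm_le hp hpmax hν
  obtain ⟨r, hr, hsub⟩ := h.exists_ball_subset_outer hp hν
  have hpos : ∀ᶠ x in 𝓝 p, x ∈ ringRegion Ei Eo → 4 * u x < 4 * b + β ^ 2 := by
    rcases hcase with ⟨h1, -⟩ | ⟨-, hβ⟩
    · exact Eventually.of_forall fun x hx => by nlinarith [h1 x hx, sq_nonneg β]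
    · have hβ2 : 0 < β ^ 2 := by nlinarith
      have hc : ContinuousWithinAt u (closure (ringRegion Ei Eo)) p :=
        h.contDiffOn_closure.continuousOn p hν.mem_closure
      have hlt : ∀ᶠ y in 𝓝 (u p), y < b + β ^ 2 / 4 :=
        gt_mem_nhds (by rw [h.outer_value p hp]; linarith)
      filter_upwards [eventually_nhdsWithin_iff.1 (hc.eventually hlt)] with x hx hxΩ
      linarith [hx (subset_closure hxΩ)]
  -- for `β < 0` squaring `√(M - 4 u) ≥ -β - 2 σ`, `σ = ‖p‖ - ‖x‖`, needs a nonnegative right side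
  have hnear : ∀ᶠ x in 𝓝 p, β < 0 → 2 * (‖p‖ - ‖x‖) < -β := by
    by_cases hβ : β < 0
    · have hc : ContinuousAt (fun x : Plane => 2 * (‖p‖ - ‖x‖)) p := by fun_prop
      filter_upwards [hc.eventually (gt_mem_nhds (show 2 * (‖p‖ - ‖p‖) < -β by linarith))]
        with x hx _ using hx
    · exact Eventually.of_forall fun x h => absurd h hβ
  obtain ⟨δ, hδ, hball⟩ := Metric.mem_nhds_iff.1
    ((h.exists_abs_sqrt_sub_abs_le hp hp0 hpmax hP hpos).and (hnear.and hpos))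
  set ρ := min r (δ / 2) with hρ
  have hρpos : 0 < ρ := by positivity
  have hρδ : ball (p - ρ • ν) ρ ⊆ ball p δ := by
    refine ball_subset_ball' ?_
    rw [dist_eq_norm, sub_sub_cancel_left, norm_neg, norm_smul, hν.norm_eq_one, mul_one,
      Real.norm_of_nonneg hρpos.le]
    linarith [min_le_right r (δ / 2)]
  have hΩ := hsub ρ hρpos (min_le_left _ _)
  have hfacts : ∀ x ∈ ball (p - ρ • ν) ρ, 0 < ‖x‖ ∧ ‖x‖ < ‖p‖ ∧
      |√(4 * b + β ^ 2 - 4 * u x) - (|β|)| ≤ 2 * (‖p‖ - ‖x‖) ∧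
      (β < 0 → 2 * (‖p‖ - ‖x‖) < -β) ∧
      √(4 * b + β ^ 2 - 4 * u x) ^ 2 = 4 * b + β ^ 2 - 4 * u x := by
    intro x hx
    obtain ⟨h1, h2, h3⟩ := hball (hρδ hx)
    obtain ⟨e1, e2, e3⟩ := h1 (hΩ hx)
    exact ⟨e1, e2, e3, h2, Real.sq_sqrt (by linarith [h3 (hΩ hx)])⟩
  have hne : ∀ x ∈ ball (p - ρ • ν) ρ, x ≠ 0 := fun x hx => norm_pos_iff.1 (hfacts x hx).1
  rcases hcase with ⟨-, hβ⟩ | ⟨-, hβ⟩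
  · refine h.false_of_touching (σ := 1) hp hp0 hpν hν hder hρpos hΩ hne ?_ ?_
    · intro x hx
      obtain ⟨e1, e2, e3, -, e5⟩ := hfacts x hx
      rw [abs_of_nonneg hβ, abs_le] at e3
      nlinarith [Real.sqrt_nonneg (4 * b + β ^ 2 - 4 * u x)]
    · intro x hx
      obtain ⟨e1, e2, -⟩ := hfacts x hx
      have : 2 < (β + 2 * ‖p‖) / ‖x‖ := by rw [lt_div_iff₀ e1]; linarith
      linarith
  · refine h.false_of_touching (σ := -1) hp hp0 hpν hν hder hρpos hΩ hne ?_ ?_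
    · intro x hx
      obtain ⟨e1, e2, e3, e4, e5⟩ := hfacts x hx
      rw [abs_of_neg hβ, abs_le] at e3
      have := e4 hβ
      nlinarith [Real.sqrt_nonneg (4 * b + β ^ 2 - 4 * u x)]
    · intro x hx
      obtain ⟨e1, e2, -, e4, -⟩ := hfacts x hx
      have : (β + 2 * ‖p‖) / ‖x‖ < 2 := by rw [div_lt_iff₀ e1]; linarith [e4 hβ]
      linarith

end IsSerrinSolution

end

theorem proposition2p1 (Ei Eo : Set Plane) (u : Plane → ℝ) (a b α β : ℝ)
    (h : IsSerrinSolution Ei Eo u a b α β) :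
    (b < a → (∀ x ∈ ringRegion Ei Eo, b < u x ∧ u x < a) →
      4 * b + β ^ 2 < 4 * a + α ^ 2 ∧ 0 ≤ α ∧ β < 0) ∧
    (a < b → (∀ x ∈ ringRegion Ei Eo, a < u x ∧ u x < b) →
      4 * b + β ^ 2 < 4 * a + α ^ 2 ∧ α < 0 ∧ 0 ≤ β) := by
  obtain ⟨p, hp, -⟩ := h.exists_farthest_point
  obtain ⟨q, hq⟩ := h.exists_mem_frontier_inner
  have hup := h.outer_value p hp
  have huq := h.inner_value q hq
  refine ⟨fun _ hu => ?_, fun _ hu => ?_⟩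
  · have hβ : β < 0 := h.normalDeriv_neg (h.outer_normal p hp)
      (fun ν hν => h.exists_ball_subset_outer hp hν) fun x hx => by rw [hup]; exact (hu x hx).1
    have hα : 0 ≤ α := (h.inner_normal q hq).nonneg_of_forall_le
      fun x hx => by rw [huq]; exact (hu x hx).2.le
    exact ⟨h.pFunction_lt (Or.inr ⟨fun x hx => (hu x hx).2, hβ⟩), hα, hβ⟩
  · have hα : α < 0 := h.normalDeriv_neg (h.inner_normal q hq)
      (fun ν hν => h.exists_ball_subset_inner hq hν) fun x hx => by rw [huq]; exact (hu x hx).1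
    have hβ : 0 ≤ β := (h.outer_normal p hp).nonneg_of_forall_le
      fun x hx => by rw [hup]; exact (hu x hx).2.le
    exact ⟨h.pFunction_lt (Or.inl ⟨fun x hx => (hu x hx).2, hβ⟩), hα, hβ⟩
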